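/- Let $M \subseteq B(H)$ be a von Neumann algebra acting on a complex Hilbert space $H$ (a $*$-subalgebra of $B(H)$ equal to its double commutant). Its weak* topology is the relative $\sigma$-weak topology, i.e. the coarsest topology making $x \mapsto \sum_n \langle x\xi_n, \eta_n\rangle$ continuous for all sequences $(\xi_n), (\eta_n)$ in $H$ with $\sum_n\|\xi_n\|^2 < \infty$ and $\sum_n\|\eta_n\|^2 < \infty$. A von Neumann subalgebra of $M$ is a weak* closed $*$-subalgebra of $M$, which need not contain the unit of $M$; it is generated by a set $S$ if it is the smallest von Neumann subalgebra of $M$ containing $S$. A state on $M$ is a positive linear functional $\phi$ on $M$ with $\phi(1) = 1$, and it is pure if it is an extreme point of the convex set of all states on $M$. For an infinite cardinal $\kappa$, a state $\phi$ on $M$ is called ${<}\,\kappa$-additive if $\phi(\sum_i p_i) = \sum_i \phi(p_i)$ for every family $(p_i)$ of fewer than $\kappa$ mutually orthogonal projections in $M$, and countably additive if this holds for every countable family of mutually orthogonal projections in $M$ (here $\sum_i p_i$ converges in the strong operator topology). **Theorem.** Let $\kappa$ be an uncountable cardinal, let $\phi$ be a ${<}\,\kappa$-additive pure state on $M$, and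 let $N$ be a von Neumann subalgebra of $M$ that is generated by fewer than $\kappa$ elements. Then the restriction of $\phi$ to $N$ is normal, i.e. weak* continuous. In particular, every countably additive pure state $\phi$ on $M$ is sequentially weak* continuous: if a sequence $(x_n)$ in $M$ converges weak* to $x \in M$, then $\phi(x_n) \to \phi(x)$. -/

import Mathlib

open scoped ComplexOrder Cardinal Topology

universe u

noncomputable section

/-- The ultraweak (`σ`-weak, weak*) topology of `B(H)`: the coarsest topology that makes
`x ↦ ∑ ⟪ηₙ, x ξₙ⟫` continuous for all square-summable sequences `ξ`, `η` in `H`.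
These functionals are exactly the elements of the predual of `B(H)`. -/
@[reducible] def ultraweakTopology (H : Type u) [NormedAddCommGroup H] [InnerProductSpace ℂ H]
    [CompleteSpace H] : TopologicalSpace (H →L[ℂ] H) :=
  ⨅ (ξ : lp (fun _ : ℕ => H) 2) (η : lp (fun _ : ℕ => H) 2),
    TopologicalSpace.induced (fun x : H →L[ℂ] H => ∑' n, inner ℂ (η n) (x (ξ n))) inferInstance

namespace VonNeumannAlgebra

variable {H : Type u} [NormedAddCommGroup H] [InnerProductSpace ℂ H] [CompleteSpace H]

/-- The weak* topology of a von Neumann algebra `M ⊆ B(H)`: the relative ultraweak topology. -/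
@[reducible] def weakStarTopology (M : VonNeumannAlgebra H) : TopologicalSpace M.toStarSubalgebra :=
  TopologicalSpace.induced (fun x => (x : H →L[ℂ] H)) (ultraweakTopology H)

variable {M : VonNeumannAlgebra H}

/-- A state on `M`: a linear functional that is positive and unital. -/
structure IsState (φ : M.toStarSubalgebra →ₗ[ℂ] ℂ) : Prop where
  nonneg : ∀ x : M.toStarSubalgebra, 0 ≤ φ (star x * x)
  map_one : φ 1 = 1

/-- A pure state on `M`: an extreme point of the convex set of all states. -/
def IsPureState (φ : M.toStarSubalgebra →ₗ[ℂ] ℂ) : Prop :=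
  φ ∈ Set.extremePoints ℝ {ψ : M.toStarSubalgebra →ₗ[ℂ] ℂ | IsState ψ}

/-- A family of mutually orthogonal projections of `M`. -/
structure IsOrthogonalProjectionFamily {ι : Type*} (p : ι → M.toStarSubalgebra) : Prop where
  isStarProjection : ∀ i, IsStarProjection (p i)
  mul_eq_zero : ∀ i j, i ≠ j → p i * p j = 0

/-- `q = ∑ pᵢ` in the strong operator topology. -/
def HasStrongSum {ι : Type*} (p : ι → M.toStarSubalgebra) (q : M.toStarSubalgebra) : Prop :=
  ∀ v : H, HasSum (fun i => (p i : H →L[ℂ] H) v) ((q : H →L[ℂ] H) v)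

/-- `φ (∑ pᵢ) = ∑ φ (pᵢ)` for every countable family of mutually orthogonal projections. -/
def IsCountablyAdditive (φ : M.toStarSubalgebra →ₗ[ℂ] ℂ) : Prop :=
  ∀ (ι : Type) [Countable ι] (p : ι → M.toStarSubalgebra) (q : M.toStarSubalgebra),
    IsOrthogonalProjectionFamily p → HasStrongSum p q → HasSum (fun i => φ (p i)) (φ q)

/-- `φ (∑ pᵢ) = ∑ φ (pᵢ)` for every family of fewer than `κ` mutually orthogonal projections. -/
def IsAdditiveBelow (κ : Cardinal.{u}) (φ : M.toStarSubalgebra →ₗ[ℂ] ℂ) : Prop :=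
  ∀ (ι : Type u), #ι < κ → ∀ (p : ι → M.toStarSubalgebra) (q : M.toStarSubalgebra),
    IsOrthogonalProjectionFamily p → HasStrongSum p q → HasSum (fun i => φ (p i)) (φ q)

/-- A von Neumann subalgebra of `M`, possibly with a unit different from that of `M`:
a weak* closed `*`-subalgebra. -/
def IsVonNeumannSubalgebra (N : NonUnitalStarSubalgebra ℂ M.toStarSubalgebra) : Prop :=
  IsClosed[M.weakStarTopology] (N : Set M.toStarSubalgebra)

/-- `N` is the smallest von Neumann subalgebra of `M` that contains the set `S`. -/
structure IsGeneratedBy (N : NonUnitalStarSubalgebra ℂ M.toStarSubalgebra)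
    (S : Set M.toStarSubalgebra) : Prop where
  isVonNeumannSubalgebra : IsVonNeumannSubalgebra N
  subset : S ⊆ N
  le : ∀ L : NonUnitalStarSubalgebra ℂ M.toStarSubalgebra,
    IsVonNeumannSubalgebra L → S ⊆ L → N ≤ L

/-- The restriction of `φ` to `N` is normal, that is, weak* continuous. -/
def IsNormalOn (φ : M.toStarSubalgebra →ₗ[ℂ] ℂ)
    (N : NonUnitalStarSubalgebra ℂ M.toStarSubalgebra) : Prop :=
  Continuous[TopologicalSpace.induced Subtype.val M.weakStarTopology, inferInstance]
    (fun x : N => φ (x : M.toStarSubalgebra))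

/-- `φ (xₙ) → φ x` for every sequence `xₙ → x` that converges weak* in `M`. -/
def IsSeqWeakStarContinuous (φ : M.toStarSubalgebra →ₗ[ℂ] ℂ) : Prop :=
  ∀ (x : ℕ → M.toStarSubalgebra) (y : M.toStarSubalgebra),
    Filter.Tendsto x Filter.atTop (@nhds _ M.weakStarTopology y) →
      Filter.Tendsto (fun n => φ (x n)) Filter.atTop (𝓝 (φ y))

end VonNeumannAlgebra

end

/-! Call a projection `p` full if `φ p = 1`. The heart of the matter is excision: for each `x` there
is a full `p` with `p * x * p = φ x • p` (`IsPureState.exists_isFull_mul_mul_eq`).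

Purity gives one half. The GNS representation of `φ` is irreducible, and an approximate transitivity
argument with norm control shows that the kernel of `φ` is the norm closure of `L + L*`, where `L`
is the left kernel (`exists_norm_sub_sub_star_lt_of_pure`).

Additivity gives the other half. A self-adjoint `h` in `L` is annihilated by a full projection, the
meet of the kernel projections of the truncations of `h²`. Meets of fewer than `κ` full projections
are full: along a well-order the successive drops are orthogonal projections of value zero, and
additivity sums them (`exists_isFull_of_wellFoundedLT`). Hence one full `p` kills a whole sequence
of approximants to `x - φ x • 1` in `L + L*`, which forces the compression of `x - φ x • 1` by `p`
to vanish.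

Finally, fewer than `κ` generators produce fewer than `κ` words, so a single full `p` excises `φ` at
all words, hence on the `*`-algebra that they span. For a unit vector `ζ` in the range of `p`, the
relation `p * x * p = ⟪ζ, x ζ⟫ • p` passes to weak* limits, and applying `φ` to it shows that `φ` is
the vector state of `ζ` on the weak* closure. -/

/-! ### Irreducible representations -/

section Irreducible

variable {A K : Type*} [CStarAlgebra A] [NormedAddCommGroup K] [InnerProductSpace ℂ K]
  [CompleteSpace K]

/-- A representation with scalar commutant. -/
def HasScalarCommutant (π : A →⋆ₐ[ℂ] (K →L[ℂ] K)) : Prop :=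
  ∀ T : K →L[ℂ] K, (∀ a, π a * T = T * π a) → ∃ c : ℂ, T = c • 1

/-- The diagonal action of an operator on a finite power of a Hilbert space. -/
noncomputable def diagonalAction (ι : Type*) [Fintype ι] (b : K →L[ℂ] K) :
    PiLp 2 (fun _ : ι => K) →L[ℂ] PiLp 2 (fun _ : ι => K) :=
  (PiLp.continuousLinearEquiv 2 ℂ (fun _ : ι => K)).symm.toContinuousLinearMap ∘L
    (ContinuousLinearMap.pi fun i => b ∘L ContinuousLinearMap.proj i) ∘L
      (PiLp.continuousLinearEquiv 2 ℂ (fun _ : ι => K)).toContinuousLinearMap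

omit [CompleteSpace K] in
@[simp]
theorem diagonalAction_apply {ι : Type*} [Fintype ι] (b : K →L[ℂ] K)
    (x : PiLp 2 (fun _ : ι => K)) (i : ι) : diagonalAction ι b x i = b (x i) := rfl

/-- The projection onto a subspace invariant under an operator and its adjoint commutes with that
operator. -/
theorem starProjection_apply_comm {E : Type*} [NormedAddCommGroup E] [InnerProductSpace ℂ E]
    (U : Submodule ℂ E) [U.HasOrthogonalProjection] (D D' : E →L[ℂ] E)
    (hadj : ∀ x y, inner ℂ x (D y) = inner ℂ (D' x) y) (hD : ∀ x ∈ U, D x ∈ U)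
    (hD' : ∀ x ∈ U, D' x ∈ U) (x : E) : U.starProjection (D x) = D (U.starProjection x) := by
  refine Submodule.eq_starProjection_of_mem_orthogonal (hD _ (U.starProjection_apply_mem x)) ?_
  rw [← map_sub, Submodule.mem_orthogonal]
  intro w hw
  rw [hadj]
  exact (Submodule.mem_orthogonal _ _).1 (U.sub_starProjection_mem_orthogonal x) _ (hD' w hw)

theorem map_star_inner (π : A →⋆ₐ[ℂ] (K →L[ℂ] K)) (a : A) (x y : K) :
    inner ℂ x (π a y) = inner ℂ (π (star a) x) y := by
  rw [map_star, ContinuousLinearMap.star_eq_adjoint, ContinuousLinearMap.adjoint_inner_left]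

/-- Finite rank functionals that vanish on an irreducible operator algebra vanish everywhere. -/
theorem HasScalarCommutant.sum_inner_eq_zero {π : A →⋆ₐ[ℂ] (K →L[ℂ] K)}
    (hπ : HasScalarCommutant π) {ι : Type*} [Fintype ι] (v w : ι → K)
    (h : ∀ a, ∑ i, inner ℂ (w i) (π a (v i)) = 0) (b : K →L[ℂ] K) :
    ∑ i, inner ℂ (w i) (b (v i)) = 0 := by
  classical
  let E := PiLp 2 (fun _ : ι => K)
  let v' : E := WithLp.toLp 2 v
  let w' : E := WithLp.toLp 2 w
  let R : Submodule ℂ E := Submodule.span ℂ (Set.range fun a => diagonalAction ι (π a) v')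
  have hRinv : ∀ a, ∀ x ∈ R, diagonalAction ι (π a) x ∈ R := by
    intro a x hx
    induction hx using Submodule.span_induction with
    | mem x hx =>
      obtain ⟨c, rfl⟩ := hx
      refine Submodule.subset_span ⟨a * c, ?_⟩
      ext i
      simp
    | zero => simp
    | add x y _ _ hx hy => rw [map_add]; exact add_mem hx hy
    | smul c x _ hx => rw [map_smul]; exact R.smul_mem c hx
  let U : Submodule ℂ E := R.topologicalClosure
  have hUinv : ∀ a, ∀ x ∈ U, diagonalAction ι (π a) x ∈ U := by
    intro a x hx
    exact map_mem_closure (diagonalAction ι (π a)).continuous hx (fun y hy => hRinv a y hy)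
  have : CompleteSpace U := R.isClosed_topologicalClosure.completeSpace_coe
  have hadj : ∀ a (x y : E), inner ℂ x (diagonalAction ι (π a) y) =
      inner ℂ (diagonalAction ι (π (star a)) x) y := by
    intro a x y
    simp only [PiLp.inner_apply, diagonalAction_apply]
    exact Finset.sum_congr rfl fun i _ => map_star_inner π a _ _
  have hcomm : ∀ a x, U.starProjection (diagonalAction ι (π a) x) =
      diagonalAction ι (π a) (U.starProjection x) := fun a x =>
    starProjection_apply_comm U _ _ (hadj a) (hUinv a) (hUinv (star a)) x
  let sgl : ι → K →L[ℂ] E := fun j =>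
    (PiLp.continuousLinearEquiv 2 ℂ (fun _ : ι => K)).symm.toContinuousLinearMap ∘L
      ContinuousLinearMap.single ℂ (fun _ : ι => K) j
  have hsgl : ∀ (b : K →L[ℂ] K) j x, diagonalAction ι b (sgl j x) = sgl j (b x) := by
    intro b j x
    ext i
    change b ((Pi.single j x : ι → K) i) = (Pi.single j (b x) : ι → K) i
    by_cases hij : i = j
    · subst hij; simp
    · simp [hij]
  have hsum : ∀ x : E, x = ∑ j, sgl j (x j) := by
    intro x
    ext i
    have : (∑ j, sgl j (x j)) i = ∑ j, (Pi.single j (x j) : ι → K) i := by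
      rw [WithLp.ofLp_sum, Finset.sum_apply]
      rfl
    rw [this, Finset.sum_pi_single]
    simp
  -- The matrix entries of the projection onto `U` commute with the representation, so they are
  -- scalars. A scalar matrix commutes with every diagonal action, so `U` contains `b` applied to
  -- `v'` for every bounded `b`, while `w'` is orthogonal to `U` by hypothesis.
  let P : ι → ι → K →L[ℂ] K := fun i j =>
    (PiLp.proj 2 (fun _ : ι => K) i : E →L[ℂ] K) ∘L U.starProjection ∘L sgl j
  have hP : ∀ i j, ∃ c : ℂ, P i j = c • 1 := by
    intro i j
    refine hπ _ fun a => ?_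
    ext x
    change π a ((U.starProjection (sgl j x)) i) = (U.starProjection (sgl j (π a x))) i
    rw [← hsgl, hcomm]
    simp
  choose c hc using hP
  have hPapp : ∀ x i, (U.starProjection x) i = ∑ j, c i j • x j := by
    intro x i
    conv_lhs => rw [hsum x, map_sum, WithLp.ofLp_sum, Finset.sum_apply]
    refine Finset.sum_congr rfl fun j _ => ?_
    change P i j (x j) = _
    rw [hc]
    simp
  have hv' : v' ∈ U := by
    refine R.le_topologicalClosure (Submodule.subset_span ⟨1, ?_⟩)
    ext i
    simp
  have hbv : diagonalAction ι b v' ∈ U := by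
    rw [← Submodule.starProjection_eq_self_iff]
    ext i
    rw [hPapp]
    have h1 := hPapp v' i
    rw [Submodule.starProjection_eq_self_iff.2 hv'] at h1
    simp only [diagonalAction_apply]
    rw [h1]
    simp
  have hw : w' ∈ Uᗮ := by
    rw [Submodule.orthogonal_closure, Submodule.mem_orthogonal']
    intro x hx
    induction hx using Submodule.span_induction with
    | mem x hx =>
      obtain ⟨a, rfl⟩ := hx
      exact (PiLp.inner_apply _ _).trans (h a)
    | zero => simp
    | add x y _ _ hx hy => rw [inner_add_right, hx, hy, add_zero]
    | smul c x _ hx => rw [inner_smul_right, hx, mul_zero]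
  exact (PiLp.inner_apply _ _).symm.trans ((Submodule.mem_orthogonal' _ _).1 hw _ hbv)

/-- Self-adjoint elements of an irreducible operator algebra approximate self-adjoint operators on
two vectors. -/
theorem HasScalarCommutant.exists_isSelfAdjoint_norm_sub_lt {π : A →⋆ₐ[ℂ] (K →L[ℂ] K)}
    (hπ : HasScalarCommutant π) {b : K →L[ℂ] K} (hb : IsSelfAdjoint b) (x y : K) {ε : ℝ}
    (hε : 0 < ε) :
    ∃ a : A, IsSelfAdjoint a ∧ ‖π a x - b x‖ < ε ∧ ‖π a y - b y‖ < ε := by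
  let f : selfAdjoint A →ₗ[ℝ] K × K :=
    { toFun := fun a => (π a x, π a y)
      map_add' := fun a c => by simp
      map_smul' := fun r a => by
        have : ((r • a : selfAdjoint A) : A) = (r : ℂ) • (a : A) := by simp
        rw [this, map_smul]
        simp }
  let R : Submodule ℝ (K × K) := LinearMap.range f
  have key : (b x, b y) ∈ closure (R : Set (K × K)) := by
    by_contra hnot
    obtain ⟨g, r, hr, hR⟩ := RCLike.geometric_hahn_banach_point_closed (𝕜 := ℂ)
      R.convex.closure isClosed_closure hnot
    -- A real linear functional bounded below by `r` on a real subspace vanishes there: otherwise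
    -- some multiple of `z` takes the value `r - 1`.
    have hzero : ∀ z ∈ R, (g z).re = 0 := by
      intro z hz
      by_contra hne
      have h1 := hR (((r - 1) / (g z).re) • z) (subset_closure (R.smul_mem _ hz))
      have h2 : g (((r - 1) / (g z).re) • z) = (((r - 1) / (g z).re : ℝ) : ℂ) * g z := by
        rw [← smul_eq_mul, ← map_smul, Complex.coe_smul]
      rw [h2] at h1
      simp only [RCLike.re_to_complex, Complex.re_ofReal_mul] at h1
      rw [div_mul_cancel₀ _ hne] at h1
      linarith
    have hr0 : (g (b x, b y)).re ≠ 0 := by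
      have h0 := hR 0 (subset_closure R.zero_mem)
      simp only [RCLike.re_to_complex, map_zero] at h0 hr
      intro h
      linarith
    let s := (InnerProductSpace.toDual ℂ K).symm (g ∘L ContinuousLinearMap.inl ℂ K K)
    let t := (InnerProductSpace.toDual ℂ K).symm (g ∘L ContinuousLinearMap.inr ℂ K K)
    have hg : ∀ u v, g (u, v) = inner ℂ s u + inner ℂ t v := by
      intro u v
      rw [InnerProductSpace.toDual_symm_apply, InnerProductSpace.toDual_symm_apply]
      simp [← map_add]
    -- For self-adjoint `c`, twice the real part of `g (c x, c y)` is a sum of four matrix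
    -- coefficients. That sum is complex linear in `c`, so its vanishing extends from the
    -- self-adjoint elements to all of `A`, and then to `b`.
    let v4 : Fin 4 → K := ![x, y, s, t]
    let w4 : Fin 4 → K := ![s, t, x, y]
    have hform : ∀ c : K →L[ℂ] K, IsSelfAdjoint c →
        ∑ i, inner ℂ (w4 i) (c (v4 i)) = ((2 * (g (c x, c y)).re : ℝ) : ℂ) := by
      intro c hc
      have h1 : ∀ p q, inner ℂ p (c q) = (starRingEnd ℂ) (inner ℂ q (c p)) := by
        intro p q
        rw [inner_conj_symm, ← ContinuousLinearMap.adjoint_inner_right,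
          ← ContinuousLinearMap.star_eq_adjoint, hc.star_eq]
      simp only [Fin.sum_univ_four, v4, w4, hg]
      simp only [Matrix.cons_val]
      rw [h1 x s, h1 y t]
      push_cast
      rw [Complex.re_eq_add_conj, map_add]
      ring
    have hA : ∀ a : A, IsSelfAdjoint a → ∑ i, inner ℂ (w4 i) (π a (v4 i)) = 0 := by
      intro a ha
      have h0 : (g (π a x, π a y)).re = 0 := hzero _ ⟨⟨a, ha⟩, rfl⟩
      rw [hform _ (ha.map π), h0]
      simp
    have hA' : ∀ a : A, ∑ i, inner ℂ (w4 i) (π a (v4 i)) = 0 := by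
      intro a
      have h1 := hA _ (realPart a).2
      have h2 := hA _ (imaginaryPart a).2
      conv_lhs => rw [← realPart_add_I_smul_imaginaryPart a]
      simp only [map_add, map_smul, add_apply, smul_apply,
        inner_add_right, inner_smul_right, Finset.sum_add_distrib, ← Finset.mul_sum, h1, h2]
      simp
    have h3 := hform b hb
    rw [hπ.sum_inner_eq_zero v4 w4 hA' b] at h3
    have h4 : 2 * (g (b x, b y)).re = 0 := by exact_mod_cast h3.symm
    exact hr0 (by linarith)
  obtain ⟨z, ⟨a, rfl⟩, hz⟩ := Metric.mem_closure_iff.1 key ε hε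
  refine ⟨a, a.2, ?_, ?_⟩
  · rw [← dist_eq_norm, dist_comm]
    exact (le_max_left _ _).trans_lt hz
  · rw [← dist_eq_norm, dist_comm]
    exact (le_max_right _ _).trans_lt hz

end Irreducible

/-! ### Transitivity with norm control -/

section Transitivity

variable {A K : Type*} [CStarAlgebra A] [NormedAddCommGroup K] [InnerProductSpace ℂ K]
  [CompleteSpace K]

/-- An irreducible operator algebra contains uniformly bounded approximations of operators that fix
one vector and annihilate an orthogonal one. -/
theorem HasScalarCommutant.exists_norm_le_two {π : A →⋆ₐ[ℂ] (K →L[ℂ] K)}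
    (hπ : HasScalarCommutant π) {w v : K} (hwv : inner ℂ w v = 0) {ε : ℝ} (hε : 0 < ε) :
    ∃ a : A, IsSelfAdjoint a ∧ ‖a‖ ≤ 2 ∧ ‖π a w - w‖ < ε ∧ ‖π a v‖ < ε := by
  obtain ⟨a, ha, haw, hav⟩ := hπ.exists_isSelfAdjoint_norm_sub_lt
    (isSelfAdjoint_starProjection (ℂ ∙ w)) w v (half_pos hε)
  have hPw : (ℂ ∙ w).starProjection w = w :=
    Submodule.starProjection_eq_self_iff.2 (Submodule.mem_span_singleton_self w)
  have hPv : (ℂ ∙ w).starProjection v = 0 := by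
    rw [Submodule.starProjection_apply_eq_zero_iff]
    exact Submodule.mem_orthogonal_singleton_iff_inner_right.2 hwv
  rw [hPw] at haw
  rw [hPv, sub_zero] at hav
  have hden : ∀ t : ℝ, 1 + t ^ 2 ≠ 0 := fun t => by positivity
  -- The element `a` has no norm bound, but `f` is bounded with `f 0 = 0` and `f 1 = 1`. The
  -- factorizations `f t = k t * t` and `f t - 1 = m t * (t - 1)` have bounded cofactors, so `f(a)`
  -- inherits the approximations at `v` and at `w`.
  let f : ℝ → ℝ := fun t => 2 * t ^ 2 / (1 + t ^ 2)
  let k : ℝ → ℝ := fun t => 2 * t / (1 + t ^ 2)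
  let m : ℝ → ℝ := fun t => (1 + t) / (1 + t ^ 2)
  have hf : Continuous f := by fun_prop (disch := assumption)
  have hk : Continuous k := by fun_prop (disch := assumption)
  have hm : Continuous m := by fun_prop (disch := assumption)
  have hfk : cfc f a = cfc k a * a := by
    conv_rhs => rw [← cfc_id' ℝ a, cfc_id' ℝ a]
    conv_rhs => rhs; rw [← cfc_id' ℝ a]
    rw [← cfc_mul k (fun x => x) a]
    refine cfc_congr fun t _ => ?_
    simp only [f, k]
    ring
  have hfm : cfc f a - 1 = cfc m a * (a - 1) := by
    have h1 : a - 1 = cfc (fun t : ℝ => t - 1) a := by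
      rw [cfc_sub (fun t : ℝ => t) (fun _ => 1) a, cfc_id' ℝ a, cfc_const_one ℝ a]
    rw [h1, ← cfc_mul m _ a, ← cfc_const_one ℝ a, ← cfc_sub f _ a]
    refine cfc_congr fun t _ => ?_
    simp only [f, m]
    field_simp [hden t]
    ring
  have hfn : ‖cfc f a‖ ≤ 2 := by
    refine norm_cfc_le (by norm_num) fun t _ => ?_
    simp only [f]
    rw [Real.norm_eq_abs, abs_div, abs_of_nonneg (by positivity), abs_of_pos (by positivity),
      div_le_iff₀ (by positivity)]
    nlinarith
  have hkn : ‖cfc k a‖ ≤ 2 := by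
    refine norm_cfc_le (by norm_num) fun t _ => ?_
    simp only [k]
    rw [Real.norm_eq_abs, abs_div, abs_of_pos (show 0 < 1 + t ^ 2 by positivity),
      div_le_iff₀ (by positivity), abs_le]
    constructor <;> nlinarith [sq_nonneg (t - 1), sq_nonneg (t + 1)]
  have hmn : ‖cfc m a‖ ≤ 2 := by
    refine norm_cfc_le (by norm_num) fun t _ => ?_
    simp only [m]
    rw [Real.norm_eq_abs, abs_div, abs_of_pos (show 0 < 1 + t ^ 2 by positivity),
      div_le_iff₀ (by positivity), abs_le]
    constructor <;> nlinarith [sq_nonneg (t - 1), sq_nonneg (t + 1)]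
  have hbound : ∀ (c : A) (x : K), ‖c‖ ≤ 2 → ‖x‖ < ε / 2 → ‖π c x‖ < ε := by
    intro c x hc hx
    have h1 : ‖π c‖ ≤ ‖c‖ := NonUnitalStarAlgHom.norm_apply_le π c
    calc ‖π c x‖ ≤ ‖π c‖ * ‖x‖ := (π c).le_opNorm x
      _ ≤ 2 * ‖x‖ := by gcongr; exact h1.trans hc
      _ < ε := by linarith
  refine ⟨cfc f a, cfc_predicate f a, hfn, ?_, ?_⟩
  · have : π (cfc f a) w - w = π (cfc m a) (π a w - w) := by
      have h2 : π (cfc f a) - 1 = π (cfc m a) * (π a - 1) := by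
        rw [← map_one π, ← map_sub, hfm, map_mul, map_sub]
      exact congrArg (fun T : K →L[ℂ] K => T w) h2
    rw [this]
    exact hbound _ _ hmn haw
  · rw [hfk, map_mul]
    exact hbound _ _ hkn hav

/-- Vectors are approximated by the orbit of a unit vector under an irreducible algebra, with norm
control. -/
theorem HasScalarCommutant.exists_norm_le_norm_sub_le {π : A →⋆ₐ[ℂ] (K →L[ℂ] K)}
    (hπ : HasScalarCommutant π) {ξ : K} (hξ : ‖ξ‖ = 1) (u : K) :
    ∃ a : A, ‖a‖ ≤ 6 * ‖u‖ ∧ ‖π a ξ - u‖ ≤ ‖u‖ / 2 := by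
  have hπn : ∀ c : ℂ, π (c • 1) = c • (1 : K →L[ℂ] K) := fun c => by simp
  have hone : ‖(1 : A)‖ ≤ 1 := by
    by_cases h : Nontrivial A
    · exact CStarRing.norm_one.le
    · rw [not_nontrivial_iff_subsingleton] at h
      rw [Subsingleton.elim (1 : A) 0, norm_zero]
      exact zero_le_one
  have hξξ : inner ℂ ξ ξ = (1 : ℂ) := by rw [inner_self_eq_norm_sq_to_K, hξ]; simp
  let l : ℂ := inner ℂ ξ u
  let u' : K := u - l • ξ
  have hu : u = l • ξ + u' := by simp [u']
  have horth : inner ℂ ξ u' = (0 : ℂ) := by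
    rw [inner_sub_right, inner_smul_right, hξξ, mul_one, sub_self]
  have horth' : inner ℂ u' ξ = (0 : ℂ) := by rw [← inner_conj_symm, horth, map_zero]
  have hl : ‖l‖ ≤ ‖u‖ := by
    have := norm_inner_le_norm (𝕜 := ℂ) ξ u
    rwa [hξ, one_mul] at this
  have hr : ‖u'‖ ≤ ‖u‖ := by
    have h1 : ‖u‖ ^ 2 = ‖l‖ ^ 2 + ‖u'‖ ^ 2 := by
      have := norm_add_sq_eq_norm_sq_add_norm_sq_of_inner_eq_zero (l • ξ) u'
        (by rw [inner_smul_left, horth, mul_zero])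
      rw [← hu, norm_smul, hξ, mul_one] at this
      nlinarith
    nlinarith [norm_nonneg u, norm_nonneg u', sq_nonneg ‖l‖]
  by_cases hu0 : u = 0
  · exact ⟨0, by simp [hu0], by simp [hu0]⟩
  have hupos : 0 < ‖u‖ := norm_pos_iff.2 hu0
  let r : ℂ := (‖u'‖ : ℝ)
  have hrn : ‖r‖ = ‖u'‖ := by simp [r]
  -- The two vectors are orthogonal because `r • ξ` and `u'` are orthogonal of equal norm. Their sum
  -- is `2r • ξ`, so if `b` nearly fixes the first and nearly kills the second, then `2r • b - r`
  -- sends `ξ` close to `u'`.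
  have hwv : inner ℂ (r • ξ + u') (r • ξ - u') = (0 : ℂ) := by
    simp only [inner_add_left, inner_sub_right, inner_smul_left, inner_smul_right, horth, horth',
      hξξ, inner_self_eq_norm_sq_to_K]
    simp [r]
    ring
  obtain ⟨b, -, hbn, hbw, hbv⟩ := hπ.exists_norm_le_two hwv (ε := ‖u‖ / 4) (by positivity)
  refine ⟨l • 1 + (2 * r) • b - r • 1, ?_, ?_⟩
  · calc _ ≤ ‖l • (1 : A)‖ + ‖(2 * r) • b‖ + ‖r • (1 : A)‖ :=
        (norm_sub_le _ _).trans (add_le_add_left (norm_add_le _ _) _)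
      _ ≤ ‖u‖ * 1 + 2 * ‖u‖ * 2 + ‖u‖ * 1 := by
        rw [norm_smul, norm_smul, norm_smul, norm_mul, hrn]
        simp only [RCLike.norm_ofNat]
        gcongr
      _ = _ := by ring
  · have h1 : π (l • 1 + (2 * r) • b - r • 1) ξ - u =
        (π b (r • ξ + u') - (r • ξ + u')) + π b (r • ξ - u') := by
      simp only [map_add, map_sub, map_smul, map_one, add_apply, sub_apply, smul_apply,
        one_apply_eq_self]
      rw [hu]
      module
    rw [h1]
    exact (norm_add_le _ _).trans (by linarith)

/-- An irreducible operator algebra acts transitively, with norm control. -/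
theorem HasScalarCommutant.exists_apply_eq {π : A →⋆ₐ[ℂ] (K →L[ℂ] K)}
    (hπ : HasScalarCommutant π) {ξ : K} (hξ : ‖ξ‖ = 1) (u : K) :
    ∃ a : A, π a ξ = u ∧ ‖a‖ ≤ 12 * ‖u‖ := by
  choose g hg1 hg2 using hπ.exists_norm_le_norm_sub_le hξ
  -- `s n` is the residual after `n` corrections. It halves each time, so the norms of the
  -- corrections sum to at most `6 * 2 * ‖u‖`.
  let s : ℕ → K := fun n => Nat.rec u (fun _ z => z - π (g z) ξ) n
  have hs : ∀ n, ‖s n‖ ≤ ‖u‖ * (1 / 2) ^ n := by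
    intro n
    induction n with
    | zero => simp [s]
    | succ n ih =>
      have h1 : ‖s (n + 1)‖ ≤ ‖s n‖ / 2 := by
        change ‖s n - π (g (s n)) ξ‖ ≤ _
        rw [norm_sub_rev]
        exact hg2 _
      rw [pow_succ]
      linarith
  have hbd : ∀ n, ‖g (s n)‖ ≤ 6 * ‖u‖ * (1 / 2) ^ n := fun n =>
    (hg1 _).trans (by nlinarith [hs n])
  have hgeo : HasSum (fun n : ℕ => 6 * ‖u‖ * (1 / 2 : ℝ) ^ n) (12 * ‖u‖) := by
    have := hasSum_geometric_two.mul_left (6 * ‖u‖)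
    rwa [show 6 * ‖u‖ * 2 = 12 * ‖u‖ by ring] at this
  have hsum : Summable fun n => g (s n) := Summable.of_norm_bounded hgeo.summable hbd
  refine ⟨∑' n, g (s n), ?_, ?_⟩
  · have hπc : Continuous π :=
      AddMonoidHomClass.continuous_of_bound π 1 fun x => by
        rw [one_mul]; exact NonUnitalStarAlgHom.norm_apply_le π x
    have h1 : Filter.Tendsto (fun n => π (∑ i ∈ Finset.range n, g (s i)) ξ) Filter.atTop
        (𝓝 (π (∑' n, g (s n)) ξ)) := by
      have h2 : Continuous fun a => π a ξ := hπc.clm_apply continuous_const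
      exact (h2.tendsto _).comp hsum.hasSum.tendsto_sum_nat
    have h3 : ∀ n, π (∑ i ∈ Finset.range n, g (s i)) ξ = u - s n := by
      intro n
      induction n with
      | zero => simp [s]
      | succ n ih =>
        rw [Finset.sum_range_succ, map_add, add_apply, ih]
        change _ = u - (s n - π (g (s n)) ξ)
        abel
    have h4 : Filter.Tendsto s Filter.atTop (𝓝 0) := by
      refine squeeze_zero_norm hs ?_
      have := (tendsto_pow_atTop_nhds_zero_of_lt_one (r := (1 / 2 : ℝ)) (by norm_num)
        (by norm_num)).const_mul ‖u‖
      simpa using this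
    simp only [h3] at h1
    exact tendsto_nhds_unique h1 (by simpa using h4.const_sub u)
  · exact tsum_of_norm_bounded hgeo hbd

/-- In an irreducible representation, an element with vanishing expectation at a unit vector is
approximated by sums of an element and the adjoint of an element that annihilate that vector. -/
theorem HasScalarCommutant.exists_norm_sub_sub_star_lt {π : A →⋆ₐ[ℂ] (K →L[ℂ] K)}
    (hπ : HasScalarCommutant π) {ξ : K} (hξ : ‖ξ‖ = 1) {x : A} (hx : inner ℂ ξ (π x ξ) = (0 : ℂ))
    {ε : ℝ} (hε : 0 < ε) :
    ∃ c d : A, π c ξ = 0 ∧ π d ξ = 0 ∧ ‖x - c - star d‖ < ε := by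
  let η : K := π (star x) ξ
  have hη : inner ℂ η ξ = (0 : ℂ) := by
    change inner ℂ (π (star x) ξ) ξ = (0 : ℂ)
    rw [← map_star_inner, hx]
  -- Write `x = x * (b - d) + x * (1 - (b - d))`, where `b` nearly fixes `η`, nearly kills `ξ`, and
  -- `d` corrects it so that `b - d` kills `ξ` exactly. The adjoint of the second summand sends `ξ`
  -- to the small vector `z`, which a small `e` corrects. The choice of `δ` makes the total error
  -- `‖e‖` less than `ε`.
  let δ : ℝ := ε / (12 * (1 + 12 * ‖η‖) + 1)
  have hδ : 0 < δ := by positivity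
  obtain ⟨b, hb, -, hbη, hbξ⟩ := hπ.exists_norm_le_two hη hδ
  obtain ⟨d, hd, hdn⟩ := hπ.exists_apply_eq hξ (π b ξ)
  have hdη : ‖π (star d) η‖ ≤ 12 * δ * ‖η‖ := by
    calc ‖π (star d) η‖ ≤ ‖π (star d)‖ * ‖η‖ := (π (star d)).le_opNorm η
      _ ≤ ‖star d‖ * ‖η‖ := by gcongr; exact NonUnitalStarAlgHom.norm_apply_le π (star d)
      _ ≤ 12 * δ * ‖η‖ := by rw [norm_star]; gcongr; linarith
  let z : K := π ((1 - star (b - d)) * star x) ξ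
  have hz : z = -(π b η - η) + π (star d) η := by
    simp only [z, η, star_sub, hb.star_eq, map_mul, map_sub, map_one]
    change π (star x) ξ - (π b (π (star x) ξ) - π (star d) (π (star x) ξ)) = _
    abel
  have hzn : ‖z‖ ≤ δ * (1 + 12 * ‖η‖) := by
    rw [hz]
    refine (norm_add_le _ _).trans ?_
    rw [norm_neg]
    linarith
  obtain ⟨e, he, hen⟩ := hπ.exists_apply_eq hξ z
  refine ⟨x * (b - d), (1 - star (b - d)) * star x - e, ?_, ?_, ?_⟩
  · rw [map_mul, map_sub]
    change π x (π b ξ - π d ξ) = 0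
    rw [hd, sub_self, map_zero]
  · rw [map_sub]
    change z - π e ξ = 0
    rw [he, sub_self]
  · have h1 : x - x * (b - d) - star ((1 - star (b - d)) * star x - e) = star e := by
      simp only [star_sub, star_mul, star_star, star_one, mul_sub, mul_one]
      abel
    rw [h1, norm_star]
    calc ‖e‖ ≤ 12 * (δ * (1 + 12 * ‖η‖)) := hen.trans (by gcongr)
      _ = δ * (12 * (1 + 12 * ‖η‖)) := by ring
      _ < δ * (12 * (1 + 12 * ‖η‖) + 1) := by gcongr; linarith
      _ = ε := by simp only [δ]; field_simp

end Transitivity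

/-! ### Pure states: irreducibility and the kernel -/

section Pure

variable {A : Type*} [CStarAlgebra A]

/-- The GNS representation of a pure state is irreducible. Purity is expressed by the absence of
nontrivial segments of states centred at `φ`. -/
theorem hasScalarCommutant_gnsStarAlgHom [PartialOrder A] [StarOrderedRing A] (φ : A →ₚ[ℂ] ℂ)
    (hpure : ∀ χ : A →ₗ[ℂ] ℂ, χ 1 = 0 → (∀ x, 0 ≤ φ (star x * x) + χ (star x * x)) →
      (∀ x, 0 ≤ φ (star x * x) - χ (star x * x)) → χ = 0) :
    HasScalarCommutant φ.gnsStarAlgHom := by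
  let π := φ.gnsStarAlgHom
  let ξ : φ.GNS := (φ.toPreGNS 1 : φ.PreGNS)
  have hπξ : ∀ a, π a ξ = (φ.toPreGNS a : φ.PreGNS) := by
    intro a
    change φ.gnsNonUnitalStarAlgHom a (φ.toPreGNS 1 : φ.PreGNS) = _
    rw [PositiveLinearMap.gnsNonUnitalStarAlgHom_apply_coe]
    simp
  have hinner : ∀ x, inner ℂ (π x ξ) (π x ξ) = φ (star x * x) := by
    intro x
    rw [hπξ, UniformSpace.Completion.inner_coe, PositiveLinearMap.preGNS_inner_def]
    simp
  have hdense : ∀ T : φ.GNS →L[ℂ] φ.GNS, (∀ a, π a * T = T * π a) → T ξ = 0 → T = 0 := by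
    intro T hT hξ
    ext y
    induction y using UniformSpace.Completion.induction_on with
    | hp => exact isClosed_eq T.continuous continuous_const
    | ih y =>
      have h1 : (y : φ.GNS) = π (φ.ofPreGNS y) ξ := by rw [hπξ]; simp
      rw [h1]
      have h2 := congrArg (fun S : φ.GNS →L[ℂ] φ.GNS => S ξ) (hT (φ.ofPreGNS y))
      change π _ (T ξ) = T (π _ ξ) at h2
      rw [← h2, hξ, map_zero, zero_apply]
  -- self-adjoint elements of the commutant with vanishing expectation are zero
  have hsa0 : ∀ T : φ.GNS →L[ℂ] φ.GNS, IsSelfAdjoint T → (∀ a, π a * T = T * π a) → ‖T‖ ≤ 1 →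
      inner ℂ ξ (T ξ) = (0 : ℂ) → T = 0 := by
    intro T hTsa hT hTn hξ
    -- As `T` commutes with the representation, `χ (star x * x)` is the quadratic form of `T` at `π
    -- x ξ`. A self-adjoint contraction thus gives a perturbation dominated by `φ`, and purity kills
    -- it.
    let χ : A →ₗ[ℂ] ℂ :=
      { toFun := fun x => inner ℂ ξ (π x (T ξ))
        map_add' := fun x y => by simp [inner_add_right]
        map_smul' := fun c x => by simp [inner_smul_right] }
    have hχ : ∀ x y, χ (star x * y) = inner ℂ (π x ξ) (T (π y ξ)) := by
      intro x y
      have h2 := congrArg (fun S : φ.GNS →L[ℂ] φ.GNS => S ξ) (hT y)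
      change π _ (T ξ) = T (π _ ξ) at h2
      change inner ℂ ξ (π (star x * y) (T ξ)) = _
      rw [map_mul, mul_apply_eq_comp, map_star_inner, star_star, h2]
    have hreal : ∀ y : φ.GNS, ∃ r : ℝ, inner ℂ y (T y) = (r : ℂ) ∧ |r| ≤ ‖y‖ ^ 2 := by
      intro y
      refine ⟨(inner ℂ y (T y)).re, ?_, ?_⟩
      · refine (Complex.conj_eq_iff_re.1 ?_).symm
        rw [inner_conj_symm, ← ContinuousLinearMap.adjoint_inner_right,
          ← ContinuousLinearMap.star_eq_adjoint, hTsa.star_eq]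
      · calc |(inner ℂ y (T y)).re| ≤ ‖inner ℂ y (T y)‖ := Complex.abs_re_le_norm _
          _ ≤ ‖y‖ * ‖T y‖ := norm_inner_le_norm _ _
          _ ≤ ‖y‖ * (1 * ‖y‖) := by gcongr; exact T.le_of_opNorm_le hTn y
          _ = ‖y‖ ^ 2 := by ring
    have hχ0 : χ = 0 := by
      refine hpure χ ?_ ?_ ?_
      · change inner ℂ ξ (π 1 (T ξ)) = 0
        rw [map_one]
        exact hξ
      · intro x
        obtain ⟨r, hr, hrle⟩ := hreal (π x ξ)
        rw [hχ, hr, ← hinner, inner_self_eq_norm_sq_to_K, RCLike.ofReal_eq_complex_ofReal]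
        have : 0 ≤ ‖π x ξ‖ ^ 2 + r := by linarith [neg_abs_le r]
        exact_mod_cast this
      · intro x
        obtain ⟨r, hr, hrle⟩ := hreal (π x ξ)
        rw [hχ, hr, ← hinner, inner_self_eq_norm_sq_to_K, RCLike.ofReal_eq_complex_ofReal]
        have : 0 ≤ ‖π x ξ‖ ^ 2 - r := by linarith [le_abs_self r]
        exact_mod_cast this
    refine hdense T hT ?_
    have h3 : ∀ y : φ.GNS, inner ℂ y (T ξ) = (0 : ℂ) := by
      intro y
      induction y using UniformSpace.Completion.induction_on with
      | hp => exact isClosed_eq (by fun_prop) continuous_const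
      | ih y =>
        have h1 : (y : φ.GNS) = π (φ.ofPreGNS y) ξ := by rw [hπξ]; simp
        have h4 := hχ (φ.ofPreGNS y) 1
        rw [hχ0, map_one] at h4
        rw [h1]
        exact h4.symm
    exact inner_self_eq_zero.1 (h3 _)
  have hsa : ∀ T : φ.GNS →L[ℂ] φ.GNS, IsSelfAdjoint T → (∀ a, π a * T = T * π a) →
      ∃ c : ℂ, T = c • 1 := by
    intro T hTsa hT
    by_cases hξ0 : ξ = 0
    · exact ⟨0, by rw [zero_smul]; exact hdense T hT (by rw [hξ0, map_zero])⟩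
    have hne : (inner ℂ ξ ξ : ℂ) ≠ 0 := inner_self_ne_zero.2 hξ0
    let r : ℝ := (inner ℂ ξ (T ξ) : ℂ).re / ‖ξ‖ ^ 2
    have hr : (r : ℂ) * inner ℂ ξ ξ = inner ℂ ξ (T ξ) := by
      have h1 : (((inner ℂ ξ (T ξ) : ℂ).re : ℝ) : ℂ) = inner ℂ ξ (T ξ) := by
        refine Complex.conj_eq_iff_re.1 ?_
        rw [inner_conj_symm, ← ContinuousLinearMap.adjoint_inner_right,
          ← ContinuousLinearMap.star_eq_adjoint, hTsa.star_eq]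
      rw [← h1, inner_self_eq_norm_sq_to_K]
      have h2 : (‖ξ‖ : ℂ) ≠ 0 := by exact_mod_cast norm_ne_zero_iff.2 hξ0
      simp only [r]
      push_cast
      simp only [RCLike.ofReal_eq_complex_ofReal]
      field_simp
    let T₀ := T - (r : ℂ) • 1
    have hT₀sa : IsSelfAdjoint T₀ := by
      refine hTsa.sub ?_
      rw [isSelfAdjoint_iff, star_smul, star_one]
      simp
    have hT₀ : ∀ a, π a * T₀ = T₀ * π a := by
      intro a
      simp only [T₀, mul_sub, sub_mul, hT, mul_smul_comm, smul_mul_assoc, mul_one, one_mul]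
    -- Rescales `T₀` into the unit ball; the summand `1` keeps the denominator nonzero.
    let s : ℂ := ((1 + ‖T₀‖ : ℝ) : ℂ)⁻¹
    have hs : s ≠ 0 := by
      refine inv_ne_zero ?_
      exact_mod_cast (by positivity : (1 + ‖T₀‖ : ℝ) ≠ 0)
    have h0 : s • T₀ = 0 := by
      refine hsa0 _ ?_ ?_ ?_ ?_
      · rw [isSelfAdjoint_iff, star_smul, hT₀sa.star_eq]
        simp [s]
      · intro a
        rw [mul_smul_comm, smul_mul_assoc, hT₀]
      · rw [norm_smul, norm_inv, Complex.norm_real, Real.norm_of_nonneg (by positivity),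
          inv_mul_le_iff₀ (by positivity)]
        linarith
      · have : inner ℂ ξ (T₀ ξ) = (0 : ℂ) := by
          simp only [T₀, sub_apply, smul_apply, inner_sub_right, inner_smul_right,
            one_apply_eq_self]
          rw [hr, sub_self]
        rw [smul_apply, inner_smul_right, this, mul_zero]
    refine ⟨r, sub_eq_zero.1 ?_⟩
    exact (smul_eq_zero.1 h0).resolve_left hs
  intro T hT
  have hTstar : ∀ a, π a * star T = star T * π a := by
    intro a
    have := congrArg star (hT (star a))
    rw [star_mul, star_mul, ← map_star, star_star] at this
    exact this.symm
  obtain ⟨c, hc⟩ := hsa (realPart T) (realPart T).2 fun a => by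
    simp only [realPart_apply_coe, mul_smul_comm, smul_mul_assoc, mul_add, add_mul, hTstar]
    rw [hT]
  obtain ⟨d, hd⟩ := hsa (imaginaryPart T) (imaginaryPart T).2 fun a => by
    simp only [imaginaryPart_apply_coe, mul_smul_comm, smul_mul_assoc, mul_sub, sub_mul, hTstar]
    rw [hT]
  refine ⟨c + Complex.I * d, ?_⟩
  rw [← realPart_add_I_smul_imaginaryPart T, hc, hd, add_smul, mul_smul]

/-- The kernel of a pure state is the closure of the sum of its left kernel and the adjoint of its
left kernel. -/
theorem exists_norm_sub_sub_star_lt_of_pure (φ : A →ₗ[ℂ] ℂ) (hpos : ∀ x, 0 ≤ φ (star x * x))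
    (hone : φ 1 = 1)
    (hpure : ∀ χ : A →ₗ[ℂ] ℂ, χ 1 = 0 → (∀ x, 0 ≤ φ (star x * x) + χ (star x * x)) →
      (∀ x, 0 ≤ φ (star x * x) - χ (star x * x)) → χ = 0)
    {x : A} (hx : φ x = 0) {ε : ℝ} (hε : 0 < ε) :
    ∃ c d : A, φ (star c * c) = 0 ∧ φ (star d * d) = 0 ∧ ‖x - c - star d‖ < ε := by
  let _ := CStarAlgebra.spectralOrder A
  have := CStarAlgebra.spectralOrderedRing A
  let Φ : A →ₚ[ℂ] ℂ := PositiveLinearMap.mk₀ φ fun a ha => by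
    obtain ⟨y, rfl⟩ := CStarAlgebra.nonneg_iff_eq_star_mul_self.1 ha
    exact hpos y
  have hΦ := hasScalarCommutant_gnsStarAlgHom Φ hpure
  let ξ : Φ.GNS := (Φ.toPreGNS 1 : Φ.PreGNS)
  have hπξ : ∀ a, Φ.gnsStarAlgHom a ξ = (Φ.toPreGNS a : Φ.PreGNS) := by
    intro a
    change Φ.gnsNonUnitalStarAlgHom a (Φ.toPreGNS 1 : Φ.PreGNS) = _
    rw [PositiveLinearMap.gnsNonUnitalStarAlgHom_apply_coe]
    simp
  have hinner : ∀ x y, inner ℂ (Φ.gnsStarAlgHom x ξ) (Φ.gnsStarAlgHom y ξ) = φ (star x * y) := by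
    intro x y
    rw [hπξ, hπξ, UniformSpace.Completion.inner_coe, PositiveLinearMap.preGNS_inner_def]
    rfl
  have hξ : ‖ξ‖ = 1 := by
    have h1 := hinner 1 1
    rw [star_one, one_mul, hone, map_one, one_apply_eq_self, inner_self_eq_norm_sq_to_K,
      RCLike.ofReal_eq_complex_ofReal] at h1
    have h2 : ‖ξ‖ ^ 2 = 1 := by exact_mod_cast h1
    nlinarith [norm_nonneg ξ]
  have hx' : inner ℂ ξ (Φ.gnsStarAlgHom x ξ) = (0 : ℂ) := by
    have h1 := hinner 1 x
    rw [star_one, one_mul, map_one, hx] at h1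
    exact h1
  obtain ⟨c, d, hc, hd, hcd⟩ := hΦ.exists_norm_sub_sub_star_lt hξ hx' hε
  refine ⟨c, d, ?_, ?_, hcd⟩
  · rw [← hinner, hc, inner_zero_left]
  · rw [← hinner, hd, inner_zero_left]

end Pure

/-! ### The left kernel of a positive functional -/

section LeftKernel

variable {A : Type*} [CStarAlgebra A] {φ : A →ₗ[ℂ] ℂ}

/-- The Cauchy-Schwarz inequality for positive functionals, in the degenerate case. -/
theorem map_mul_eq_zero_of_map_star_mul_self (hpos : ∀ x, 0 ≤ φ (star x * x)) {x : A}
    (hx : φ (star x * x) = 0) (y : A) : φ (y * x) = 0 ∧ φ (star x * y) = 0 := by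
  let _ := CStarAlgebra.spectralOrder A
  have := CStarAlgebra.spectralOrderedRing A
  let Φ : A →ₚ[ℂ] ℂ := PositiveLinearMap.mk₀ φ fun a ha => by
    obtain ⟨y, rfl⟩ := CStarAlgebra.nonneg_iff_eq_star_mul_self.1 ha
    exact hpos y
  have hinner : ∀ a b : A, inner ℂ (Φ.toPreGNS a) (Φ.toPreGNS b) = φ (star a * b) := fun _ _ => rfl
  have h0 : ‖Φ.toPreGNS x‖ = 0 := by
    have h1 := Φ.preGNS_norm_sq (Φ.toPreGNS x)
    rw [show Φ (star (Φ.ofPreGNS (Φ.toPreGNS x)) * Φ.ofPreGNS (Φ.toPreGNS x)) = 0 from hx] at h1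
    have h2 : ‖Φ.toPreGNS x‖ ^ 2 = 0 := by exact_mod_cast h1
    exact pow_eq_zero_iff two_ne_zero |>.1 h2
  constructor
  · have h1 := norm_inner_le_norm (𝕜 := ℂ) (Φ.toPreGNS (star y)) (Φ.toPreGNS x)
    rw [h0, mul_zero, hinner, star_star] at h1
    exact norm_le_zero_iff.1 h1
  · have h1 := norm_inner_le_norm (𝕜 := ℂ) (Φ.toPreGNS x) (Φ.toPreGNS y)
    rw [h0, zero_mul, hinner] at h1
    exact norm_le_zero_iff.1 h1

theorem map_star_mul_self_mul_left (hpos : ∀ x, 0 ≤ φ (star x * x)) {x : A}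
    (hx : φ (star x * x) = 0) (y : A) : φ (star (y * x) * (y * x)) = 0 := by
  rw [← mul_assoc]
  exact (map_mul_eq_zero_of_map_star_mul_self hpos hx _).1

theorem map_star_mul_self_add (hpos : ∀ x, 0 ≤ φ (star x * x)) {x y : A}
    (hx : φ (star x * x) = 0) (hy : φ (star y * y) = 0) : φ (star (x + y) * (x + y)) = 0 := by
  rw [star_add, add_mul, mul_add, mul_add]
  simp only [map_add, hx, hy, (map_mul_eq_zero_of_map_star_mul_self hpos hx _).1,
    (map_mul_eq_zero_of_map_star_mul_self hpos hy _).1, add_zero]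

end LeftKernel

/-! ### Projections of `M` and their meets -/

namespace VonNeumannAlgebra

variable {H : Type u} [NormedAddCommGroup H] [InnerProductSpace ℂ H] [CompleteSpace H]
  {M : VonNeumannAlgebra H}

/-- Centralizers are norm closed and `M` is a double centralizer. As a local instance, this makes
`M` a C*-algebra, so that the functional calculus and the results on pure states apply to it. -/
theorem isClosed_toStarSubalgebra : IsClosed (M.toStarSubalgebra : Set (H →L[ℂ] H)) := by
  rw [coe_toStarSubalgebra, ← centralizer_centralizer]
  exact Set.isClosed_centralizer _

/-- A closed subspace invariant under the commutant of `M` is the range of a projection of `M`. -/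
theorem exists_isStarProjection_apply_eq_iff_mem (U : Submodule ℂ H) (hU : IsClosed (U : Set H))
    (hinv : ∀ g ∈ M.commutant, ∀ v ∈ U, g v ∈ U) :
    ∃ p : M.toStarSubalgebra, IsStarProjection p ∧ ∀ v, (p : H →L[ℂ] H) v = v ↔ v ∈ U := by
  have : CompleteSpace U := hU.completeSpace_coe
  have hmem : U.starProjection ∈ M := by
    rw [← M.commutant_commutant, mem_commutant_iff]
    intro g hg
    ext v
    refine (starProjection_apply_comm U g (star g) (fun x y => ?_) (hinv g hg)
      (hinv _ (star_mem hg)) v).symm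
    rw [ContinuousLinearMap.star_eq_adjoint, ContinuousLinearMap.adjoint_inner_left]
  refine ⟨⟨U.starProjection, hmem⟩, ⟨?_, ?_⟩, fun v => Submodule.starProjection_eq_self_iff⟩
  · exact Subtype.ext isStarProjection_starProjection.isIdempotentElem
  · exact Subtype.ext isStarProjection_starProjection.isSelfAdjoint

/-- The kernel projection of an element of `M`. -/
theorem exists_isStarProjection_apply_eq_iff_eq_zero (y : M.toStarSubalgebra) :
    ∃ p : M.toStarSubalgebra, IsStarProjection p ∧
      ∀ v, (p : H →L[ℂ] H) v = v ↔ (y : H →L[ℂ] H) v = 0 := by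
  refine exists_isStarProjection_apply_eq_iff_mem (LinearMap.ker (y : H →L[ℂ] H).toLinearMap)
    (y : H →L[ℂ] H).isClosed_ker fun g hg v hv => ?_
  have h1 := congrArg (fun T : H →L[ℂ] H => T v) (mem_commutant_iff.1 hg y y.2)
  change (y : H →L[ℂ] H) (g v) = g ((y : H →L[ℂ] H) v) at h1
  change (y : H →L[ℂ] H) (g v) = 0
  rw [h1, show (y : H →L[ℂ] H) v = 0 from hv, map_zero]

/-- The meet of a family of projections of `M`. -/
theorem exists_isStarProjection_apply_eq_iff_forall {I : Type*} (p : I → M.toStarSubalgebra)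
    (s : Set I) :
    ∃ q : M.toStarSubalgebra, IsStarProjection q ∧
      ∀ v, (q : H →L[ℂ] H) v = v ↔ ∀ i ∈ s, (p i : H →L[ℂ] H) v = v := by
  let U : Submodule ℂ H :=
    ⨅ i ∈ s, LinearMap.ker ((p i : H →L[ℂ] H) - 1).toLinearMap
  have hmem : ∀ v, v ∈ U ↔ ∀ i ∈ s, (p i : H →L[ℂ] H) v = v := by
    intro v
    simp only [U, Submodule.mem_iInf]
    refine forall₂_congr fun i _ => ?_
    change (p i : H →L[ℂ] H) v - v = 0 ↔ _
    exact sub_eq_zero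
  have hclosed : IsClosed (U : Set H) := by
    have : (U : Set H) = ⋂ i ∈ s, {v | (p i : H →L[ℂ] H) v = v} := by
      ext v
      simp [hmem v]
    rw [this]
    exact isClosed_biInter fun i _ => isClosed_eq (p i : H →L[ℂ] H).continuous continuous_id
  have hinv : ∀ g ∈ M.commutant, ∀ v ∈ U, g v ∈ U := by
    intro g hg v hv
    rw [hmem] at hv ⊢
    intro i hi
    have h1 := congrArg (fun T : H →L[ℂ] H => T v) (mem_commutant_iff.1 hg (p i) (p i).2)
    change (p i : H →L[ℂ] H) (g v) = g ((p i : H →L[ℂ] H) v) at h1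
    rw [h1, hv i hi]
  obtain ⟨q, hq, hqv⟩ := exists_isStarProjection_apply_eq_iff_mem U hclosed hinv
  exact ⟨q, hq, fun v => (hqv v).trans (hmem v)⟩

/-- With `x = q`, this converts an inclusion of fixed spaces into the algebraic order relation `p *
q = q`. -/
theorem mul_eq_of_forall_apply_eq {p q x : M.toStarSubalgebra} (hq : q * x = x)
    (h : ∀ v, (q : H →L[ℂ] H) v = v → (p : H →L[ℂ] H) v = v) : p * x = x := by
  refine Subtype.ext (ContinuousLinearMap.ext fun v => ?_)
  change (p : H →L[ℂ] H) ((x : H →L[ℂ] H) v) = (x : H →L[ℂ] H) v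
  exact h _ (congrArg (fun T : M.toStarSubalgebra => (T : H →L[ℂ] H) v) hq)

theorem mul_eq_right_of_mul_eq_left {p q : M.toStarSubalgebra} (hp : IsStarProjection p)
    (hq : IsStarProjection q) (h : p * q = q) : q * p = q := by
  have := congrArg star h
  rwa [star_mul, hp.isSelfAdjoint.star_eq, hq.isSelfAdjoint.star_eq] at this

/-- An orthogonal family of projections sums to the complement of the projection onto the
intersection of their kernels. -/
theorem IsOrthogonalProjectionFamily.hasStrongSum_one_sub {ι : Type*} {D : ι → M.toStarSubalgebra}
    (hD : IsOrthogonalProjectionFamily D) {q : M.toStarSubalgebra}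
    (hqD : ∀ i, q * D i = 0)
    (hker : ∀ v, (∀ i, (D i : H →L[ℂ] H) v = 0) → (q : H →L[ℂ] H) v = v) :
    HasStrongSum D (1 - q) := by
  classical
  intro v
  have hsa : ∀ i x y, inner ℂ ((D i : H →L[ℂ] H) x) y = inner ℂ x ((D i : H →L[ℂ] H) y) := by
    intro i x y
    have h1 : star (D i : H →L[ℂ] H) = D i :=
      congrArg Subtype.val (hD.isStarProjection i).isSelfAdjoint.star_eq
    rw [← ContinuousLinearMap.adjoint_inner_right, ← ContinuousLinearMap.star_eq_adjoint, h1]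
  have hDD : ∀ i j x, i ≠ j → (D i : H →L[ℂ] H) ((D j : H →L[ℂ] H) x) = 0 := fun i j x hij =>
    congrArg (fun T : M.toStarSubalgebra => (T : H →L[ℂ] H) x) (hD.mul_eq_zero i j hij)
  have hDi : ∀ i x, (D i : H →L[ℂ] H) ((D i : H →L[ℂ] H) x) = (D i : H →L[ℂ] H) x := fun i x =>
    congrArg (fun T : M.toStarSubalgebra => (T : H →L[ℂ] H) x)
      (hD.isStarProjection i).isIdempotentElem
  have hqDx : ∀ i x, (q : H →L[ℂ] H) ((D i : H →L[ℂ] H) x) = 0 := fun i x =>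
    congrArg (fun T : M.toStarSubalgebra => (T : H →L[ℂ] H) x) (hqD i)
  let G : ι → Submodule ℂ H := fun i => LinearMap.range (D i : H →L[ℂ] H).toLinearMap
  have hG : OrthogonalFamily ℂ (fun i => G i) fun i => (G i).subtypeₗᵢ := by
    rintro i j hij ⟨-, x, rfl⟩ ⟨-, y, rfl⟩
    change inner ℂ ((D i : H →L[ℂ] H) x) ((D j : H →L[ℂ] H) y) = 0
    rw [hsa, hDD i j y hij, inner_zero_right]
  let f : ∀ i, G i := fun i => ⟨(D i : H →L[ℂ] H) v, v, rfl⟩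
  -- Bessel's inequality: a partial sum `S` satisfies `‖S‖² = ⟪S, v⟫ ≤ ‖S‖ * ‖v‖`.
  have hsq : Summable fun i => ‖f i‖ ^ 2 := by
    refine summable_of_sum_le (c := ‖v‖ ^ 2) (fun i => sq_nonneg _) fun s => ?_
    have h1 : ‖∑ i ∈ s, (D i : H →L[ℂ] H) v‖ ^ 2 = ∑ i ∈ s, ‖f i‖ ^ 2 := hG.norm_sum f s
    have h2 : ((∑ i ∈ s, ‖f i‖ ^ 2 : ℝ) : ℂ) = inner ℂ (∑ i ∈ s, (D i : H →L[ℂ] H) v) v := by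
      rw [sum_inner, Complex.ofReal_sum]
      refine Finset.sum_congr rfl fun i _ => ?_
      rw [← hDi, hsa]
      have := inner_self_eq_norm_sq_to_K (𝕜 := ℂ) ((D i : H →L[ℂ] H) v)
      rw [this]
      simp [f]
    have h3 : ∑ i ∈ s, ‖f i‖ ^ 2 ≤ ‖∑ i ∈ s, (D i : H →L[ℂ] H) v‖ * ‖v‖ := by
      have := norm_inner_le_norm (𝕜 := ℂ) (∑ i ∈ s, (D i : H →L[ℂ] H) v) v
      rw [← h2, Complex.norm_real, Real.norm_of_nonneg
        (Finset.sum_nonneg fun i _ => sq_nonneg _)] at this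
      exact this
    rw [← h1] at h3 ⊢
    have h4 := norm_nonneg (∑ i ∈ s, (D i : H →L[ℂ] H) v)
    have h5 := norm_nonneg v
    by_contra hlt
    push Not at hlt
    have h6 := lt_of_pow_lt_pow_left₀ 2 h4 hlt
    nlinarith
  have hsum : Summable fun i => (D i : H →L[ℂ] H) v := (hG.summable_iff_norm_sq_summable f).2 hsq
  obtain ⟨z, hz⟩ := hsum
  -- Hence every `D j` kills `v - z`, so `q` fixes `v - z`. Since `q z = 0`, this gives `z = v - q
  -- v`.
  have hDz : ∀ j, (D j : H →L[ℂ] H) z = (D j : H →L[ℂ] H) v := by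
    intro j
    have h1 := hz.mapL (D j : H →L[ℂ] H)
    refine h1.unique ?_
    have h2 := hasSum_single (f := fun i => (D j : H →L[ℂ] H) ((D i : H →L[ℂ] H) v)) j
      fun i hij => hDD j i v hij.symm
    simpa only [hDi] using h2
  have hqz : (q : H →L[ℂ] H) z = 0 := by
    refine (hz.mapL (q : H →L[ℂ] H)).unique ?_
    simp only [hqDx]
    exact hasSum_zero
  have h1 := hker (v - z) fun i => by rw [map_sub, hDz, sub_self]
  rw [map_sub, hqz, sub_zero] at h1
  have h2 : ((1 - q : M.toStarSubalgebra) : H →L[ℂ] H) v = z := by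
    change v - (q : H →L[ℂ] H) v = z
    rw [h1]
    abel
  rw [h2]
  exact hz

/-- A projection of `M` at which `φ` takes the value `1`. -/
structure IsFull (φ : M.toStarSubalgebra →ₗ[ℂ] ℂ) (p : M.toStarSubalgebra) : Prop where
  isStarProjection : IsStarProjection p
  map_eq_one : φ p = 1

/-- Meets of well-ordered families of full projections are full if the successor steps are. -/
theorem exists_isFull_of_wellFoundedLT {φ : M.toStarSubalgebra →ₗ[ℂ] ℂ} (hφ : φ 1 = 1)
    {κ : Cardinal.{u}} (hadd : IsAdditiveBelow κ φ) {I : Type u} [LinearOrder I]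
    [WellFoundedLT I] (hI : #I < κ) (p : I → M.toStarSubalgebra)
    (hstep : ∀ (i : I) (q q' : M.toStarSubalgebra), IsFull φ q → IsStarProjection q' →
      (∀ v, (q : H →L[ℂ] H) v = v ↔ ∀ j < i, (p j : H →L[ℂ] H) v = v) →
      (∀ v, (q' : H →L[ℂ] H) v = v ↔ ∀ j ≤ i, (p j : H →L[ℂ] H) v = v) → φ q' = 1) :
    ∃ q, IsFull φ q ∧ ∀ v, (q : H →L[ℂ] H) v = v ↔ ∀ i, (p i : H →L[ℂ] H) v = v := by
  choose q hq hqv using exists_isStarProjection_apply_eq_iff_forall (M := M) p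
  have hle : ∀ s t : Set I, t ⊆ s → q t * q s = q s := fun s t hts =>
    mul_eq_of_forall_apply_eq (hq s).isIdempotentElem fun v hv =>
      (hqv t v).2 fun i hi => (hqv s v).1 hv i (hts hi)
  have hle' : ∀ s t : Set I, t ⊆ s → q s * q t = q s := fun s t hts =>
    mul_eq_right_of_mul_eq_left (hq t) (hq s) (hle s t hts)
  -- The drops from `q (Iio i)` to `q (Iic i)` are orthogonal and sum to `1 - q s`. Each has value
  -- zero, so additivity gives `φ (1 - q s) = 0`. The case `s = Iio i` drives the transfinite
  -- induction, and `s = univ` finishes it.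
  have hlimit : ∀ s : Set I, IsLowerSet s →
      (∀ i ∈ s, φ (q (Set.Iio i)) = 1 ∧ φ (q (Set.Iic i)) = 1) → φ (q s) = 1 := by
    intro s hs hφs
    let D : s → M.toStarSubalgebra := fun i => q (Set.Iio (i : I)) - q (Set.Iic (i : I))
    have hD : IsOrthogonalProjectionFamily D := by
      have hlt : ∀ i j : s, i < j → D i * D j = 0 := by
        intro i j hij
        have h1 : Set.Iic (i : I) ⊆ Set.Iio (j : I) := fun k hk => lt_of_le_of_lt hk hij
        have h2 : Set.Iio (i : I) ⊆ Set.Iio (j : I) := Set.Iio_subset_Iic_self.trans h1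
        simp only [D, sub_mul, mul_sub]
        rw [hle _ _ h1, hle _ _ h2, hle _ _ (h1.trans Set.Iio_subset_Iic_self),
          hle _ _ (h2.trans Set.Iio_subset_Iic_self), sub_self, sub_self, sub_self]
      have hproj : ∀ i, IsStarProjection (D i) := fun i =>
        IsStarProjection.sub_of_mul_eq_left (hq _) (hq _) (hle' _ _ Set.Iio_subset_Iic_self)
      refine ⟨hproj, fun i j hij => ?_⟩
      rcases lt_or_gt_of_ne hij with h | h
      · exact hlt i j h
      · have := congrArg star (hlt j i h)
        rwa [star_mul, (hproj i).isSelfAdjoint.star_eq, (hproj j).isSelfAdjoint.star_eq,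
          star_zero] at this
    have hIic : ∀ i ∈ s, Set.Iic i ⊆ s := fun i hi k hk => hs hk hi
    have hsum : HasStrongSum D (1 - q s) := by
      refine hD.hasStrongSum_one_sub (fun i => ?_) fun v hv => ?_
      · simp only [D, mul_sub]
        rw [hle' _ _ (hIic i i.2), hle' _ _ (Set.Iio_subset_Iic_self.trans (hIic i i.2)), sub_self]
      · rw [hqv]
        intro i
        induction i using WellFoundedLT.induction with
        | ind i ih =>
          intro hi
          have h1 : (q (Set.Iio i) : H →L[ℂ] H) v = v :=
            (hqv _ v).2 fun j hj => ih j hj (hs (le_of_lt hj) hi)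
          have h2 : (q (Set.Iio i) : H →L[ℂ] H) v - (q (Set.Iic i) : H →L[ℂ] H) v = 0 :=
            hv ⟨i, hi⟩
          rw [h1, sub_eq_zero] at h2
          exact (hqv _ v).1 h2.symm i le_rfl
    have hφsum := hadd s ((Cardinal.mk_set_le s).trans_lt hI) D _ hD hsum
    have hzero : ∀ i, φ (D i) = 0 := fun i => by
      simp only [D, map_sub]
      rw [(hφs i i.2).1, (hφs i i.2).2, sub_self]
    simp only [hzero] at hφsum
    have := hφsum.unique hasSum_zero
    rw [map_sub, hφ, sub_eq_zero] at this
    exact this.symm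
  have hall : ∀ i, φ (q (Set.Iio i)) = 1 ∧ φ (q (Set.Iic i)) = 1 := by
    intro i
    induction i using WellFoundedLT.induction with
    | ind i ih =>
      have h1 := hlimit (Set.Iio i) (isLowerSet_Iio i) ih
      exact ⟨h1, hstep i _ _ ⟨hq _, h1⟩ (hq _) (hqv _) (hqv _)⟩
  refine ⟨q Set.univ, ⟨hq _, hlimit _ isLowerSet_univ fun i _ => hall i⟩, fun v => ?_⟩
  simpa using hqv Set.univ v

end VonNeumannAlgebra

/-! ### Full projections and excision -/

/-- Continuous truncations `max (h² - t) 0` of the square of a self-adjoint element. -/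
theorem IsSelfAdjoint.exists_truncation {A : Type*} [CStarAlgebra A] {h : A}
    (hsa : IsSelfAdjoint h) : ∃ y : ℝ → A, (∀ t, 0 < t → ∃ k, y t * (1 - k * h) = 0) ∧
      (∀ s t, s ≤ t → ∃ r, y t = r * y s) ∧ ∀ t, 0 < t → ‖h * h - y t‖ ≤ t := by
  let f : ℝ → ℝ → ℝ := fun t x => max (x ^ 2 - t) 0
  have hf : ∀ t, Continuous (f t) := fun t => by fun_prop
  refine ⟨fun t => cfc (f t) h, fun t ht => ?_, fun s t hst => ?_, fun t ht => ?_⟩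
  · let k : ℝ → ℝ := fun x => x / max (x ^ 2) t
    have hden : ∀ x : ℝ, max (x ^ 2) t ≠ 0 := fun x => (ht.trans_le (le_max_right _ _)).ne'
    have hk : Continuous k := by fun_prop (disch := assumption)
    refine ⟨cfc k h, ?_⟩
    have h2 : cfc k h * h = cfc (fun x => k x * x) h := by
      rw [cfc_mul k (fun x => x) h, cfc_id' ℝ h]
    rw [h2, mul_sub, mul_one, ← cfc_mul (f t) (fun x => k x * x) h, sub_eq_zero]
    refine cfc_congr fun x _ => ?_
    simp only [f, k]
    rcases le_total (x ^ 2) t with hx | hx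
    · rw [max_eq_right (by linarith), zero_mul]
    · have hx0 : x ^ 2 ≠ 0 := (ht.trans_le hx).ne'
      rw [max_eq_left hx, div_mul_eq_mul_div, ← pow_two, div_self hx0, mul_one]
  · rcases hst.eq_or_lt with rfl | hst
    · exact ⟨1, (one_mul _).symm⟩
    let r : ℝ → ℝ := fun x => max (x ^ 2 - t) 0 / max (x ^ 2 - s) (t - s)
    have hden : ∀ x : ℝ, max (x ^ 2 - s) (t - s) ≠ 0 := fun x =>
      ((sub_pos.2 hst).trans_le (le_max_right _ _)).ne'
    have hr : Continuous r := by fun_prop (disch := assumption)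
    refine ⟨cfc r h, ?_⟩
    change cfc (f t) h = cfc r h * cfc (f s) h
    rw [← cfc_mul r (f s) h]
    refine cfc_congr fun x _ => ?_
    simp only [f, r]
    rcases le_total (x ^ 2) t with hx | hx
    · rw [max_eq_right (a := x ^ 2 - t) (by linarith), zero_div, zero_mul]
    · have hx0 : x ^ 2 - s ≠ 0 := by linarith
      rw [max_eq_left (a := x ^ 2 - t) (by linarith), max_eq_left (b := t - s) (by linarith),
        max_eq_left (b := (0 : ℝ)) (by linarith), div_mul_cancel₀ _ hx0]
  · have h2 : h * h = cfc (fun x : ℝ => x ^ 2) h := by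
      rw [cfc_pow_id (R := ℝ) h 2, pow_two]
    rw [h2]
    change ‖_ - cfc (f t) h‖ ≤ t
    rw [← cfc_sub _ (f t) h]
    refine norm_cfc_le ht.le fun x _ => ?_
    simp only [f, Real.norm_eq_abs]
    rcases le_total (x ^ 2) t with hx | hx
    · rw [max_eq_right (by linarith), sub_zero, abs_of_nonneg (sq_nonneg x)]
      exact hx
    · rw [max_eq_left (by linarith), sub_sub_cancel, abs_of_pos ht]

namespace VonNeumannAlgebra

variable {H : Type u} [NormedAddCommGroup H] [InnerProductSpace ℂ H] [CompleteSpace H]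
  {M : VonNeumannAlgebra H} {φ : M.toStarSubalgebra →ₗ[ℂ] ℂ}

attribute [local instance] isClosed_toStarSubalgebra

theorem IsFull.map_star_one_sub_mul_self (hφ : IsState φ) {p : M.toStarSubalgebra}
    (hp : IsFull φ p) : φ (star (1 - p) * (1 - p)) = 0 := by
  rw [hp.isStarProjection.one_sub.isSelfAdjoint.star_eq,
    hp.isStarProjection.one_sub.isIdempotentElem, map_sub, hφ.map_one, hp.map_eq_one, sub_self]

/-- Since `1 - p` lies in the left kernel, Cauchy-Schwarz makes `φ` blind to multiplication by `p`
on either side. -/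
theorem IsFull.map_mul_mul (hφ : IsState φ) {p : M.toStarSubalgebra} (hp : IsFull φ p)
    (x : M.toStarSubalgebra) : φ (p * x * p) = φ x := by
  have h0 := hp.map_star_one_sub_mul_self hφ
  have h1 := (map_mul_eq_zero_of_map_star_mul_self hφ.nonneg h0 (p * x)).1
  have h2 := (map_mul_eq_zero_of_map_star_mul_self hφ.nonneg h0 x).2
  rw [hp.isStarProjection.one_sub.isSelfAdjoint.star_eq, sub_mul, one_mul, map_sub,
    sub_eq_zero] at h2
  rw [mul_sub, mul_one, map_sub, sub_eq_zero] at h1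
  rw [← h1, ← h2]

theorem IsFull.of_map_star_one_sub_mul_self {p : M.toStarSubalgebra} (hφ : IsState φ) (hp : IsStarProjection p)
    (h : φ (star (1 - p) * (1 - p)) = 0) : IsFull φ p := by
  refine ⟨hp, ?_⟩
  rw [hp.one_sub.isSelfAdjoint.star_eq, hp.one_sub.isIdempotentElem, map_sub, hφ.map_one,
    sub_eq_zero] at h
  exact h.symm

/-- A self-adjoint element of the left kernel of an additive state is annihilated by a full
projection. -/
theorem exists_isFull_mul_eq_zero_of_isSelfAdjoint (hφ : IsState φ) {κ : Cardinal.{u}}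
    (hκ : ℵ₀ < κ) (hadd : IsAdditiveBelow κ φ) {h : M.toStarSubalgebra} (hsa : IsSelfAdjoint h)
    (hh : φ (star h * h) = 0) : ∃ p, IsFull φ p ∧ h * p = 0 := by
  obtain ⟨y, hyk, hyr, hyn⟩ := hsa.exists_truncation
  choose P hP hPv using fun t => exists_isStarProjection_apply_eq_iff_eq_zero (y t)
  have hPfull : ∀ t, 0 < t → IsFull φ (P t) := by
    intro t ht
    obtain ⟨k, hk⟩ := hyk t ht
    have h2 : P t * (1 - k * h) = 1 - k * h := by
      refine Subtype.ext (ContinuousLinearMap.ext fun v => ?_)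
      exact (hPv t _).2 (congrArg (fun T : M.toStarSubalgebra => (T : H →L[ℂ] H) v) hk)
    refine IsFull.of_map_star_one_sub_mul_self hφ (hP t) ?_
    -- The range of `1 - k * h` lies in the kernel of `y t`, so `1 - P t` is a left multiple of `h`.
    -- The left kernel is a left ideal, so it contains `1 - P t`.
    have h3 : 1 - P t = (1 - P t) * k * h := by
      have h4 : (1 - P t) * (1 - k * h) = 0 := by rw [sub_mul, h2, one_mul, sub_self]
      rw [mul_sub, mul_one, sub_eq_zero] at h4
      rw [mul_assoc]
      exact h4
    rw [h3]
    exact map_star_mul_self_mul_left hφ.nonneg hh _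
  have hanti : ∀ s t, s ≤ t → ∀ v, (y s : H →L[ℂ] H) v = 0 → (y t : H →L[ℂ] H) v = 0 := by
    intro s t hst v hv
    obtain ⟨r, hr⟩ := hyr s t hst
    rw [hr]
    change (r : H →L[ℂ] H) ((y s : H →L[ℂ] H) v) = 0
    rw [hv, map_zero]
  let a : ULift.{u} ℕ → ℝ := fun n => 1 / ((n.down : ℝ) + 1)
  have ha : ∀ n, 0 < a n := fun n => by positivity
  have haanti : ∀ m n, m ≤ n → a n ≤ a m := fun m n hmn => by
    have h2 : (m.down : ℝ) ≤ n.down := by exact_mod_cast hmn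
    exact one_div_le_one_div_of_le (by positivity) (by linarith)
  -- The projections `P (a n)` decrease with `n`, so the meet up to `i` is `P (a i)` itself. No
  -- result on meets of two full projections is needed; that result is deduced from this lemma.
  have hstep : ∀ (i : ULift.{u} ℕ) (q q' : M.toStarSubalgebra), IsFull φ q → IsStarProjection q' →
      (∀ v, (q : H →L[ℂ] H) v = v ↔ ∀ j < i, (P (a j) : H →L[ℂ] H) v = v) →
      (∀ v, (q' : H →L[ℂ] H) v = v ↔ ∀ j ≤ i, (P (a j) : H →L[ℂ] H) v = v) → φ q' = 1 := by
    intro i q q' _ hq' _ hv'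
    have h2 : ∀ v, (q' : H →L[ℂ] H) v = v ↔ (P (a i) : H →L[ℂ] H) v = v := by
      intro v
      rw [hv']
      refine ⟨fun h => h i le_rfl, fun h j hj => ?_⟩
      rw [hPv] at h ⊢
      exact hanti _ _ (haanti j i hj) v h
    have h3 := mul_eq_of_forall_apply_eq hq'.isIdempotentElem fun v => (h2 v).1
    have h4 := mul_eq_of_forall_apply_eq (hP (a i)).isIdempotentElem fun v => (h2 v).2
    have h1 : q' = P (a i) := by
      rw [← h4]
      exact (mul_eq_right_of_mul_eq_left (hP _) hq' h3).symm
    rw [h1]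
    exact (hPfull _ (ha i)).map_eq_one
  obtain ⟨q, hq, hqv⟩ := exists_isFull_of_wellFoundedLT hφ.map_one hadd (I := ULift.{u} ℕ)
    (by simpa using hκ) (fun n => P (a n)) hstep
  have hhv : ∀ v, (q : H →L[ℂ] H) v = v → (h : H →L[ℂ] H) v = 0 := by
    intro v hv
    rw [hqv] at hv
    have h2 : (h : H →L[ℂ] H) ((h : H →L[ℂ] H) v) = 0 := by
      rw [← norm_le_zero_iff]
      have h3 : ∀ n : ℕ, ‖(h : H →L[ℂ] H) ((h : H →L[ℂ] H) v)‖ ≤ 1 / ((n : ℝ) + 1) * ‖v‖ := by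
        intro n
        have h4 := (hPv _ v).1 (hv ⟨n⟩)
        have h5 : (h : H →L[ℂ] H) ((h : H →L[ℂ] H) v) =
            ((h * h - y (a ⟨n⟩) : M.toStarSubalgebra) : H →L[ℂ] H) v := by
          change _ = (h : H →L[ℂ] H) ((h : H →L[ℂ] H) v) - (y (a ⟨n⟩) : H →L[ℂ] H) v
          rw [h4, sub_zero]
        rw [h5]
        exact ContinuousLinearMap.le_of_opNorm_le _ (hyn _ (ha ⟨n⟩)) v
      have h4 := (tendsto_one_div_add_atTop_nhds_zero_nat (𝕜 := ℝ)).mul_const ‖v‖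
      rw [zero_mul] at h4
      exact ge_of_tendsto' h4 h3
    have hsa' : star (h : H →L[ℂ] H) = h := congrArg Subtype.val hsa.star_eq
    have h6 := ContinuousLinearMap.adjoint_inner_left (h : H →L[ℂ] H) v ((h : H →L[ℂ] H) v)
    rw [← ContinuousLinearMap.star_eq_adjoint, hsa', h2] at h6
    have h7 := ContinuousLinearMap.adjoint_inner_right (h : H →L[ℂ] H) v ((h : H →L[ℂ] H) v)
    rw [← ContinuousLinearMap.star_eq_adjoint, hsa', h2, inner_zero_right] at h7
    exact inner_self_eq_zero.1 h7.symm
  refine ⟨q, hq, Subtype.ext (ContinuousLinearMap.ext fun v => hhv _ ?_)⟩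
  exact congrArg (fun T : M.toStarSubalgebra => (T : H →L[ℂ] H) v)
    hq.isStarProjection.isIdempotentElem

/-- The kernel of `c* c + d* d` is the intersection of the kernels of `c` and `d`. -/
theorem mul_eq_zero_of_star_mul_self_add {c d p : M.toStarSubalgebra}
    (h : (star c * c + star d * d) * p = 0) : c * p = 0 ∧ d * p = 0 := by
  have h1 : ∀ v, (c : H →L[ℂ] H) ((p : H →L[ℂ] H) v) = 0 ∧
      (d : H →L[ℂ] H) ((p : H →L[ℂ] H) v) = 0 := by
    intro v
    let w := (p : H →L[ℂ] H) v
    have h2 : (star (c : H →L[ℂ] H)) ((c : H →L[ℂ] H) w) +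
        (star (d : H →L[ℂ] H)) ((d : H →L[ℂ] H) w) = 0 :=
      congrArg (fun T : M.toStarSubalgebra => (T : H →L[ℂ] H) v) h
    have h3 := congrArg (inner ℂ w) h2
    rw [inner_add_right, inner_zero_right, ContinuousLinearMap.star_eq_adjoint,
      ContinuousLinearMap.star_eq_adjoint, ContinuousLinearMap.adjoint_inner_right,
      ContinuousLinearMap.adjoint_inner_right, inner_self_eq_norm_sq_to_K,
      inner_self_eq_norm_sq_to_K, RCLike.ofReal_eq_complex_ofReal] at h3
    have h4 : ‖(c : H →L[ℂ] H) w‖ ^ 2 + ‖(d : H →L[ℂ] H) w‖ ^ 2 = 0 := by exact_mod_cast h3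
    have h5 := sq_nonneg ‖(c : H →L[ℂ] H) w‖
    have h6 := sq_nonneg ‖(d : H →L[ℂ] H) w‖
    constructor
    · exact norm_eq_zero.1 (pow_eq_zero_iff two_ne_zero |>.1 (by linarith))
    · exact norm_eq_zero.1 (pow_eq_zero_iff two_ne_zero |>.1 (by linarith))
  exact ⟨Subtype.ext (ContinuousLinearMap.ext fun v => (h1 v).1),
    Subtype.ext (ContinuousLinearMap.ext fun v => (h1 v).2)⟩

/-- Two elements of the left kernel of an additive state are annihilated by a common full
projection. -/
theorem exists_isFull_mul_eq_zero (hφ : IsState φ) {κ : Cardinal.{u}} (hκ : ℵ₀ < κ)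
    (hadd : IsAdditiveBelow κ φ) {c d : M.toStarSubalgebra} (hc : φ (star c * c) = 0)
    (hd : φ (star d * d) = 0) : ∃ p, IsFull φ p ∧ c * p = 0 ∧ d * p = 0 := by
  obtain ⟨p, hp, hhp⟩ := exists_isFull_mul_eq_zero_of_isSelfAdjoint hφ hκ hadd
    ((IsSelfAdjoint.star_mul_self c).add (IsSelfAdjoint.star_mul_self d))
    (map_star_mul_self_add hφ.nonneg (map_star_mul_self_mul_left hφ.nonneg hc _)
      (map_star_mul_self_mul_left hφ.nonneg hd _))
  exact ⟨p, hp, mul_eq_zero_of_star_mul_self_add hhp⟩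

/-- Fewer than `κ` full projections of a `κ`-additive state have a common full subprojection. -/
theorem exists_isFull_forall_mul_eq (hφ : IsState φ) {κ : Cardinal.{u}} (hκ : ℵ₀ < κ)
    (hadd : IsAdditiveBelow κ φ) {I : Type u} (hI : #I < κ) {p : I → M.toStarSubalgebra}
    (hp : ∀ i, IsFull φ (p i)) : ∃ q, IsFull φ q ∧ ∀ i, p i * q = q := by
  obtain ⟨_, _⟩ := exists_wellFoundedLT I
  obtain ⟨q, hq, hqv⟩ := exists_isFull_of_wellFoundedLT hφ.map_one hadd hI p (by
    intro i q q' hq hq' hv hv'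
    obtain ⟨r, hr, hr1, hr2⟩ := exists_isFull_mul_eq_zero hφ hκ hadd
      (hq.map_star_one_sub_mul_self hφ) ((hp i).map_star_one_sub_mul_self hφ)
    rw [sub_mul, one_mul, sub_eq_zero] at hr1 hr2
    have h1 : q' * r = r := by
      refine Subtype.ext (ContinuousLinearMap.ext fun v => ?_)
      change (q' : H →L[ℂ] H) ((r : H →L[ℂ] H) v) = (r : H →L[ℂ] H) v
      rw [hv']
      have h2 : (q : H →L[ℂ] H) ((r : H →L[ℂ] H) v) = (r : H →L[ℂ] H) v :=
        congrArg (fun T : M.toStarSubalgebra => (T : H →L[ℂ] H) v) hr1.symm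
      have h3 : (p i : H →L[ℂ] H) ((r : H →L[ℂ] H) v) = (r : H →L[ℂ] H) v :=
        congrArg (fun T : M.toStarSubalgebra => (T : H →L[ℂ] H) v) hr2.symm
      intro j hj
      rcases hj.eq_or_lt with rfl | hj
      · exact h3
      · exact (hv _).1 h2 j hj
    have h4 : φ (star (1 - q') * (1 - q')) = 0 := by
      have h5 : 1 - q' = (1 - q') * (1 - r) := by
        rw [mul_sub, mul_one, sub_mul 1 q' r, h1, one_mul, sub_self, sub_zero]
      rw [h5]
      exact map_star_mul_self_mul_left hφ.nonneg (hr.map_star_one_sub_mul_self hφ) _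
    exact (IsFull.of_map_star_one_sub_mul_self hφ hq' h4).map_eq_one)
  exact ⟨q, hq, fun i => mul_eq_of_forall_apply_eq hq.isStarProjection.isIdempotentElem
    fun v hv => (hqv v).1 hv i⟩

/-- `φ` is the midpoint of the states `φ + χ` and `φ - χ`. This is the form of purity used for the
GNS representation. -/
theorem IsPureState.eq_zero_of_add_sub (hφ : IsPureState φ) (χ : M.toStarSubalgebra →ₗ[ℂ] ℂ)
    (hχ1 : χ 1 = 0) (hadd : ∀ x, 0 ≤ φ (star x * x) + χ (star x * x))
    (hsub : ∀ x, 0 ≤ φ (star x * x) - χ (star x * x)) : χ = 0 := by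
  have hst : IsState φ := hφ.1
  have h1 : IsState (φ + χ) := ⟨hadd, by rw [LinearMap.add_apply, hst.map_one, hχ1, add_zero]⟩
  have h2 : IsState (φ - χ) := ⟨hsub, by rw [LinearMap.sub_apply, hst.map_one, hχ1, sub_zero]⟩
  have h3 : φ ∈ openSegment ℝ (φ + χ) (φ - χ) := by
    refine ⟨1 / 2, 1 / 2, by norm_num, by norm_num, by norm_num, ?_⟩
    module
  have h4 : φ + χ = φ := hφ.2 h1 h2 h3
  exact left_eq_add.1 h4.symm

/-- A pure state that is additive below an uncountable cardinal is excised by a projection at each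
element. -/
theorem IsPureState.exists_isFull_mul_mul_eq (hφ : IsPureState φ) {κ : Cardinal.{u}} (hκ : ℵ₀ < κ)
    (hadd : IsAdditiveBelow κ φ) (x : M.toStarSubalgebra) :
    ∃ p, IsFull φ p ∧ p * x * p = φ x • p := by
  have hst : IsState φ := hφ.1
  obtain ⟨y, hyx⟩ : ∃ y, y = x - φ x • 1 := ⟨_, rfl⟩
  have hy : φ y = 0 := by
    rw [hyx, map_sub, map_smul, hst.map_one, smul_eq_mul, mul_one, sub_self]
  have h1 : ∀ n : ULift.{u} ℕ, ∃ c d p : M.toStarSubalgebra, IsFull φ p ∧ c * p = 0 ∧ d * p = 0 ∧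
      ‖y - c - star d‖ < 1 / ((n.down : ℝ) + 1) := by
    intro n
    obtain ⟨c, d, hc, hd, hcd⟩ := exists_norm_sub_sub_star_lt_of_pure φ hst.nonneg hst.map_one
      hφ.eq_zero_of_add_sub hy (ε := 1 / ((n.down : ℝ) + 1)) (by positivity)
    obtain ⟨p, hp, hcp, hdp⟩ := exists_isFull_mul_eq_zero hst hκ hadd hc hd
    exact ⟨c, d, p, hp, hcp, hdp, hcd⟩
  choose c d p hp hcp hdp hcd using h1
  -- Below all `p n`, the projection `q` kills every `c n` and `d n`, so compressing `y` by `q`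
  -- leaves only the approximation error, for every `n`.
  obtain ⟨q, hq, hpq⟩ := exists_isFull_forall_mul_eq hst hκ hadd (I := ULift.{u} ℕ)
    (by simpa using hκ) hp
  have hqn : ‖q‖ ≤ 1 := IsStarProjection.norm_le q hq.isStarProjection
  have h2 : ∀ n : ℕ, ‖q * y * q‖ ≤ 1 / ((n : ℝ) + 1) := by
    intro n
    have hcq : c ⟨n⟩ * q = 0 := by rw [← hpq ⟨n⟩, ← mul_assoc, hcp, zero_mul]
    have hdq : q * star (d ⟨n⟩) = 0 := by
      have h3 : d ⟨n⟩ * q = 0 := by rw [← hpq ⟨n⟩, ← mul_assoc, hdp, zero_mul]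
      have h4 := congrArg star h3
      rwa [star_mul, hq.isStarProjection.isSelfAdjoint.star_eq, star_zero] at h4
    have h3 : q * y * q = q * (y - c ⟨n⟩ - star (d ⟨n⟩)) * q := by
      rw [mul_sub, hdq, sub_zero, mul_sub, sub_mul, mul_assoc q (c ⟨n⟩) q, hcq, mul_zero, sub_zero]
    rw [h3]
    calc _ ≤ ‖q‖ * ‖y - c ⟨n⟩ - star (d ⟨n⟩)‖ * ‖q‖ :=
        (norm_mul_le _ _).trans (mul_le_mul_of_nonneg_right (norm_mul_le _ _) (norm_nonneg _))
      _ ≤ 1 * ‖y - c ⟨n⟩ - star (d ⟨n⟩)‖ * 1 := by gcongr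
      _ ≤ _ := by rw [one_mul, mul_one]; exact (hcd ⟨n⟩).le
  have h3 : q * y * q = 0 := by
    rw [← norm_le_zero_iff]
    exact ge_of_tendsto' (tendsto_one_div_add_atTop_nhds_zero_nat (𝕜 := ℝ)) h2
  refine ⟨q, hq, ?_⟩
  simp only [hyx, mul_sub, sub_mul, mul_smul_comm, smul_mul_assoc, mul_one,
    hq.isStarProjection.isIdempotentElem.eq] at h3
  exact sub_eq_zero.1 h3

/-- A pure state that is additive below an uncountable cardinal is simultaneously excised by a
projection at fewer than `κ` elements. -/
theorem IsPureState.exists_isFull_forall_mul_mul_eq (hφ : IsPureState φ) {κ : Cardinal.{u}}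
    (hκ : ℵ₀ < κ) (hadd : IsAdditiveBelow κ φ) {I : Type u} (hI : #I < κ)
    (x : I → M.toStarSubalgebra) :
    ∃ q, IsFull φ q ∧ ∀ i, q * x i * q = φ (x i) • q := by
  choose p hp hpx using fun i => hφ.exists_isFull_mul_mul_eq hκ hadd (x i)
  obtain ⟨q, hq, hpq⟩ := exists_isFull_forall_mul_eq hφ.1 hκ hadd hI hp
  refine ⟨q, hq, fun i => ?_⟩
  have hqp := mul_eq_right_of_mul_eq_left (hp i).isStarProjection hq.isStarProjection (hpq i)
  calc q * x i * q = (q * p i) * x i * (p i * q) := by rw [hqp, hpq]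
    _ = q * (p i * x i * p i) * q := by simp only [mul_assoc]
    _ = φ (x i) • q := by
      rw [hpx, mul_smul_comm, smul_mul_assoc, hqp, hq.isStarProjection.isIdempotentElem.eq]

end VonNeumannAlgebra

/-! ### The weak* topology and weak* closures -/

/-- The closure of a set that is stable under a separately continuous operation is stable. -/
theorem mem_closure_of_separatelyContinuous {α : Type*} [TopologicalSpace α] {s : Set α}
    {op : α → α → α} (hop : ∀ a ∈ s, ∀ b ∈ s, op a b ∈ s) (hl : ∀ a, Continuous (op a))
    (hr : ∀ b, Continuous fun a => op a b) {a b : α} (ha : a ∈ closure s) (hb : b ∈ closure s) :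
    op a b ∈ closure s := by
  have h1 : ∀ a ∈ s, op a b ∈ closure s := fun a ha => map_mem_closure (hl a) hb (hop a ha)
  have h2 := map_mem_closure (hr b) ha h1
  rwa [closure_closure] at h2

namespace VonNeumannAlgebra

variable {H : Type u} [NormedAddCommGroup H] [InnerProductSpace ℂ H] [CompleteSpace H]

/-- The image of a square-summable sequence under a bounded operator. -/
noncomputable def mapSquareSummable (T : H →L[ℂ] H) (ξ : lp (fun _ : ℕ => H) 2) :
    lp (fun _ : ℕ => H) 2 :=
  ⟨fun n => T (ξ n), by
    refine memℓp_gen ?_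
    have h1 : Summable fun n => ‖ξ n‖ ^ (2 : ENNReal).toReal := (lp.memℓp ξ).summable (by norm_num)
    refine Summable.of_nonneg_of_le (fun n => by positivity) (fun n => ?_)
      (h1.mul_left (‖T‖ ^ (2 : ENNReal).toReal))
    rw [← Real.mul_rpow (norm_nonneg _) (norm_nonneg _)]
    exact Real.rpow_le_rpow (norm_nonneg _) (T.le_opNorm _) (by norm_num)⟩

omit [CompleteSpace H] in
@[simp]
theorem mapSquareSummable_apply (T : H →L[ℂ] H) (ξ : lp (fun _ : ℕ => H) 2) (n : ℕ) :
    mapSquareSummable T ξ n = T (ξ n) := rfl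

variable {M : VonNeumannAlgebra H}

/-- Writing the defining functionals as inner products in `ℓ²(H)` lets the later continuity proofs
use linearity and conjugation without returning to summability. -/
theorem continuous_weakStar_inner_mapSquareSummable (ξ η : lp (fun _ : ℕ => H) 2) :
    Continuous[M.weakStarTopology, inferInstance]
      fun x : M.toStarSubalgebra => inner ℂ η (mapSquareSummable (x : H →L[ℂ] H) ξ) := by
  have h1 : Continuous[ultraweakTopology H, inferInstance]
      fun x : H →L[ℂ] H => ∑' n, inner ℂ (η n) (x (ξ n)) :=
    continuous_iInf_dom (i := ξ) (continuous_iInf_dom (i := η) continuous_induced_dom)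
  have h2 : Continuous[M.weakStarTopology, ultraweakTopology H]
      fun x : M.toStarSubalgebra => (x : H →L[ℂ] H) := continuous_induced_dom
  have h3 := @Continuous.comp _ _ _ M.weakStarTopology (ultraweakTopology H) _ _ _ h1 h2
  let _ := M.weakStarTopology
  exact h3.congr fun x => (lp.inner_eq_tsum η (mapSquareSummable (x : H →L[ℂ] H) ξ)).symm

/-- Continuity for the weak* topology is tested on square-summable sequences. -/
theorem continuous_weakStar_of_inner {f : M.toStarSubalgebra → M.toStarSubalgebra}
    (hf : ∀ ξ η : lp (fun _ : ℕ => H) 2, Continuous[M.weakStarTopology, inferInstance]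
      fun x : M.toStarSubalgebra => inner ℂ η (mapSquareSummable (f x : H →L[ℂ] H) ξ)) :
    Continuous[M.weakStarTopology, M.weakStarTopology] f := by
  refine continuous_induced_rng.2 (continuous_iInf_rng.2 fun ξ => continuous_iInf_rng.2 fun η =>
    continuous_induced_rng.2 ?_)
  let _ := M.weakStarTopology
  exact (hf ξ η).congr fun x => lp.inner_eq_tsum η (mapSquareSummable (f x : H →L[ℂ] H) ξ)

theorem continuous_weakStar_inner (a b : H) :
    Continuous[M.weakStarTopology, inferInstance]
      fun x : M.toStarSubalgebra => inner ℂ a ((x : H →L[ℂ] H) b) := by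
  let _ := M.weakStarTopology
  refine (continuous_weakStar_inner_mapSquareSummable (M := M) (lp.single 2 0 b)
    (lp.single 2 0 a)).congr fun x => ?_
  rw [lp.inner_eq_tsum, tsum_eq_single 0]
  · simp
  · intro n hn
    simp [hn]

theorem continuous_weakStar_add_left (a : M.toStarSubalgebra) :
    Continuous[M.weakStarTopology, M.weakStarTopology] fun x => a + x := by
  let _ := M.weakStarTopology
  refine continuous_weakStar_of_inner fun ξ η => ?_
  have h1 := (continuous_weakStar_inner_mapSquareSummable (M := M) ξ η).const_add
    (inner ℂ η (mapSquareSummable (a : H →L[ℂ] H) ξ))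
  refine h1.congr fun x => ?_
  rw [← inner_add_right]
  rfl

theorem continuous_weakStar_const_smul (c : ℂ) :
    Continuous[M.weakStarTopology, M.weakStarTopology] fun x : M.toStarSubalgebra => c • x := by
  let _ := M.weakStarTopology
  refine continuous_weakStar_of_inner fun ξ η => ?_
  have h1 := (continuous_weakStar_inner_mapSquareSummable (M := M) ξ η).const_smul c
  refine h1.congr fun x => ?_
  rw [Pi.smul_apply, smul_eq_mul, ← inner_smul_right]
  rfl

theorem continuous_weakStar_mul_left (a : M.toStarSubalgebra) :
    Continuous[M.weakStarTopology, M.weakStarTopology] fun x => a * x := by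
  let _ := M.weakStarTopology
  refine continuous_weakStar_of_inner fun ξ η => ?_
  refine (continuous_weakStar_inner_mapSquareSummable (M := M) ξ
    (mapSquareSummable (star (a : H →L[ℂ] H)) η)).congr fun x => ?_
  rw [lp.inner_eq_tsum, lp.inner_eq_tsum]
  refine tsum_congr fun n => ?_
  simp only [mapSquareSummable_apply, ContinuousLinearMap.star_eq_adjoint,
    ContinuousLinearMap.adjoint_inner_left]
  rfl

theorem continuous_weakStar_mul_right (a : M.toStarSubalgebra) :
    Continuous[M.weakStarTopology, M.weakStarTopology] fun x => x * a := by
  refine continuous_weakStar_of_inner fun ξ η => ?_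
  exact continuous_weakStar_inner_mapSquareSummable (M := M)
    (mapSquareSummable (a : H →L[ℂ] H) ξ) η

theorem continuous_weakStar_star :
    Continuous[M.weakStarTopology, M.weakStarTopology]
      (star : M.toStarSubalgebra → M.toStarSubalgebra) := by
  let _ := M.weakStarTopology
  refine continuous_weakStar_of_inner fun ξ η => ?_
  refine (continuous_weakStar_inner_mapSquareSummable (M := M) η ξ).star.congr fun x => ?_
  rw [← starRingEnd_apply, inner_conj_symm, lp.inner_eq_tsum, lp.inner_eq_tsum]
  refine tsum_congr fun n => ?_
  change inner ℂ ((x : H →L[ℂ] H) (η n)) (ξ n) = inner ℂ (η n) (star (x : H →L[ℂ] H) (ξ n))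
  rw [ContinuousLinearMap.star_eq_adjoint, ContinuousLinearMap.adjoint_inner_right]

/-- The weak* closure of a `*`-subalgebra. -/
noncomputable def weakStarClosure (B : StarSubalgebra ℂ M.toStarSubalgebra) :
    NonUnitalStarSubalgebra ℂ M.toStarSubalgebra where
  carrier := @closure _ M.weakStarTopology B
  add_mem' ha hb := by
    refine @mem_closure_of_separatelyContinuous _ M.weakStarTopology _ (fun a b => a + b)
      (fun a ha b hb => add_mem ha hb) continuous_weakStar_add_left (fun b => ?_) _ _ ha hb
    simpa only [add_comm] using continuous_weakStar_add_left b
  zero_mem' := @subset_closure _ M.weakStarTopology _ _ B.zero_mem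
  mul_mem' ha hb :=
    @mem_closure_of_separatelyContinuous _ M.weakStarTopology _ (fun a b => a * b)
      (fun a ha b hb => mul_mem ha hb) continuous_weakStar_mul_left
      continuous_weakStar_mul_right _ _ ha hb
  smul_mem' c _ ha := @map_mem_closure _ _ M.weakStarTopology M.weakStarTopology _ _ _ _
    (continuous_weakStar_const_smul c) ha fun _ hx => B.smul_mem hx c
  star_mem' ha := @map_mem_closure _ _ M.weakStarTopology M.weakStarTopology _ _ _ _
    continuous_weakStar_star ha fun _ hx => star_mem hx

theorem isVonNeumannSubalgebra_weakStarClosure (B : StarSubalgebra ℂ M.toStarSubalgebra) :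
    IsVonNeumannSubalgebra (weakStarClosure B) :=
  @isClosed_closure _ M.weakStarTopology _

theorem subset_weakStarClosure (B : StarSubalgebra ℂ M.toStarSubalgebra) :
    (B : Set M.toStarSubalgebra) ⊆ weakStarClosure B :=
  @subset_closure _ M.weakStarTopology _

/-! ### From excision to vector states and normality -/

variable {φ : M.toStarSubalgebra →ₗ[ℂ] ℂ}

theorem IsFull.exists_norm_eq_one {p : M.toStarSubalgebra} (hp : IsFull φ p) :
    ∃ ζ : H, ‖ζ‖ = 1 ∧ (p : H →L[ℂ] H) ζ = ζ := by
  have h1 : ∃ v, (p : H →L[ℂ] H) v ≠ 0 := by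
    by_contra! h
    have h2 : p = 0 := Subtype.ext (ContinuousLinearMap.ext h)
    have h3 := hp.map_eq_one
    rw [h2, map_zero] at h3
    exact zero_ne_one h3
  obtain ⟨v, hv⟩ := h1
  have h2 : (p : H →L[ℂ] H) ((p : H →L[ℂ] H) v) = (p : H →L[ℂ] H) v :=
    congrArg (fun T : M.toStarSubalgebra => (T : H →L[ℂ] H) v) hp.isStarProjection.isIdempotentElem
  refine ⟨((‖(p : H →L[ℂ] H) v‖⁻¹ : ℝ) : ℂ) • (p : H →L[ℂ] H) v, ?_, ?_⟩
  · rw [norm_smul, Complex.norm_real, norm_inv, norm_norm,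
      inv_mul_cancel₀ (norm_ne_zero_iff.2 hv)]
  · rw [map_smul, h2]

theorem inner_mul_mul_apply {p : M.toStarSubalgebra} (hp : IsStarProjection p)
    (x : M.toStarSubalgebra) (v w : H) :
    inner ℂ ((p : H →L[ℂ] H) v) ((x : H →L[ℂ] H) ((p : H →L[ℂ] H) w)) =
      inner ℂ v (((p * x * p : M.toStarSubalgebra) : H →L[ℂ] H) w) := by
  have h1 : star (p : H →L[ℂ] H) = p := congrArg Subtype.val hp.isSelfAdjoint.star_eq
  rw [← ContinuousLinearMap.adjoint_inner_right, ← ContinuousLinearMap.star_eq_adjoint, h1]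
  rfl

/-- A state excised by a projection is a vector state at that element. -/
theorem eq_inner_of_mul_mul_eq {p x : M.toStarSubalgebra} (hp : IsStarProjection p)
    {ζ : H} (hζ : ‖ζ‖ = 1) (hpζ : (p : H →L[ℂ] H) ζ = ζ) {c : ℂ} (hx : p * x * p = c • p) :
    inner ℂ ζ ((x : H →L[ℂ] H) ζ) = c := by
  have h1 := inner_mul_mul_apply hp x ζ ζ
  rw [hx, hpζ] at h1
  rw [h1]
  change inner ℂ ζ (c • (p : H →L[ℂ] H) ζ) = c
  rw [hpζ, inner_smul_right, inner_self_eq_norm_sq_to_K, hζ]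
  simp

/-- A pure state that is additive below an uncountable cardinal is a vector state on the weak*
closure of a `*`-algebra with fewer generators. -/
theorem IsPureState.exists_eq_inner_on_weakStarClosure (hφ : IsPureState φ) {κ : Cardinal.{u}}
    (hκ : ℵ₀ < κ) (hadd : IsAdditiveBelow κ φ) {S : Set M.toStarSubalgebra} (hS : #S < κ) :
    ∃ ζ : H, ∀ x ∈ weakStarClosure (StarAlgebra.adjoin ℂ S),
      φ x = inner ℂ ζ ((x : H →L[ℂ] H) ζ) := by
  have hst : IsState φ := hφ.1
  let G : Set M.toStarSubalgebra := S ∪ star S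
  -- Words in `S ∪ star S` number at most `max ℵ₀ #G`, and uncountability of `κ` keeps this below
  -- `κ`. They span the `*`-algebra, and excision by a fixed `p` is a linear condition.
  have hG : #(FreeMonoid G) < κ := by
    have h1 : #(star S : Set M.toStarSubalgebra) ≤ #S := by
      rw [← Set.image_star]
      exact Cardinal.mk_image_le
    have h2 : #G < κ :=
      (Cardinal.mk_union_le S (star S)).trans_lt
        (Cardinal.add_lt_of_lt hκ.le hS (h1.trans_lt hS))
    exact (Cardinal.mk_list_le_max G).trans_lt (max_lt hκ h2)
  obtain ⟨p, hp, hpx⟩ := hφ.exists_isFull_forall_mul_mul_eq hκ hadd hG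
    fun w => FreeMonoid.lift (Subtype.val : G → M.toStarSubalgebra) w
  obtain ⟨ζ, hζ, hpζ⟩ := hp.exists_norm_eq_one
  have hadj : ∀ x ∈ StarAlgebra.adjoin ℂ S, p * x * p = φ x • p := by
    intro x hx
    have h1 : x ∈ Subalgebra.toSubmodule (StarAlgebra.adjoin ℂ S).toSubalgebra := hx
    rw [StarAlgebra.adjoin_eq_span] at h1
    clear hx
    induction h1 using Submodule.span_induction with
    | mem x hx =>
      rw [SetLike.mem_coe, Submonoid.closure_eq_mrange] at hx
      obtain ⟨w, rfl⟩ := hx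
      exact hpx w
    | zero => rw [mul_zero, zero_mul, map_zero, zero_smul]
    | add x y _ _ ihx ihy => rw [mul_add, add_mul, map_add, add_smul, ihx, ihy]
    | smul c x _ ihx => rw [mul_smul_comm, smul_mul_assoc, ihx, map_smul, smul_assoc]
  -- Continuity of `φ` is not yet known, so `φ x` is replaced by `⟪ζ, x ζ⟫`. In matrix coefficients
  -- both sides are then weak* continuous in `x`, and the identity passes to the closure.
  have hcl : ∀ x ∈ weakStarClosure (StarAlgebra.adjoin ℂ S), ∀ v w : H,
      inner ℂ ((p : H →L[ℂ] H) v) ((x : H →L[ℂ] H) ((p : H →L[ℂ] H) w)) =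
        inner ℂ ζ ((x : H →L[ℂ] H) ζ) * inner ℂ v ((p : H →L[ℂ] H) w) := by
    intro x hx v w
    let _ := M.weakStarTopology
    have hclosed : IsClosed {x : M.toStarSubalgebra |
        inner ℂ ((p : H →L[ℂ] H) v) ((x : H →L[ℂ] H) ((p : H →L[ℂ] H) w)) =
          inner ℂ ζ ((x : H →L[ℂ] H) ζ) * inner ℂ v ((p : H →L[ℂ] H) w)} :=
      isClosed_eq (continuous_weakStar_inner _ _)
        ((continuous_weakStar_inner _ _).mul continuous_const)
    refine closure_minimal (fun y hy => ?_) hclosed hx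
    have h1 := hadj y hy
    rw [Set.mem_ofPred_eq, eq_inner_of_mul_mul_eq hp.isStarProjection hζ hpζ h1,
      inner_mul_mul_apply hp.isStarProjection, h1, ← inner_smul_right]
    rfl
  refine ⟨ζ, fun x hx => ?_⟩
  have h1 : p * x * p = (inner ℂ ζ ((x : H →L[ℂ] H) ζ) : ℂ) • p := by
    refine Subtype.ext (ContinuousLinearMap.ext fun w => ext_inner_left ℂ fun v => ?_)
    rw [← inner_mul_mul_apply hp.isStarProjection, hcl x hx v w, ← inner_smul_right]
    rfl
  rw [← hp.map_mul_mul hst, h1, map_smul, hp.map_eq_one, smul_eq_mul, mul_one]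

/-- By minimality `N` lies in the weak* closure of the unital `*`-algebra generated by `S`, where
`φ` is a vector state. The inclusion suffices, so the unit of `N` plays no role. -/
theorem IsPureState.isNormalOn (hφ : IsPureState φ) {κ : Cardinal.{u}} (hκ : ℵ₀ < κ)
    (hadd : IsAdditiveBelow κ φ) {N : NonUnitalStarSubalgebra ℂ M.toStarSubalgebra}
    {S : Set M.toStarSubalgebra} (hS : #S < κ) (hN : IsGeneratedBy N S) : IsNormalOn φ N := by
  obtain ⟨ζ, hζ⟩ := hφ.exists_eq_inner_on_weakStarClosure hκ hadd hS
  have hle := hN.le _ (isVonNeumannSubalgebra_weakStarClosure (StarAlgebra.adjoin ℂ S))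
    ((StarAlgebra.subset_adjoin ℂ S).trans (subset_weakStarClosure _))
  let _ := M.weakStarTopology
  let _ : TopologicalSpace N := TopologicalSpace.induced Subtype.val M.weakStarTopology
  have h1 : Continuous fun x : N => inner ℂ ζ (((x : M.toStarSubalgebra) : H →L[ℂ] H) ζ) :=
    (continuous_weakStar_inner ζ ζ).comp continuous_induced_dom
  exact h1.congr fun x => (hζ x (hle x.2)).symm

/-- Fewer than `ℵ₁` indices means countably many; `Shrink` moves the index type to the lowest
universe. -/
theorem IsCountablyAdditive.isAdditiveBelow_aleph_one (hadd : IsCountablyAdditive φ) :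
    IsAdditiveBelow (Cardinal.aleph 1) φ := by
  intro ι hι p q hp hq
  have : Countable ι := by
    rw [← Cardinal.succ_aleph0, Order.lt_succ_iff] at hι
    exact Cardinal.mk_le_aleph0_iff.1 hι
  have : Small.{0} ι := Countable.toSmall ι
  let e : ι ≃ Shrink.{0} ι := equivShrink.{0} ι
  have : Countable (Shrink.{0} ι) := e.symm.injective.countable
  have h1 := hadd (Shrink.{0} ι) (fun i => p (e.symm i)) q
    ⟨fun i => hp.isStarProjection _, fun i j hij => hp.mul_eq_zero _ _ (e.symm.injective.ne hij)⟩
    fun v => (e.symm.hasSum_iff (f := fun i => (p i : H →L[ℂ] H) v)).2 (hq v)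
  exact (e.symm.hasSum_iff (f := fun i => φ (p i))).1 h1

theorem IsPureState.isSeqWeakStarContinuous (hφ : IsPureState φ) (hadd : IsCountablyAdditive φ) :
    IsSeqWeakStarContinuous φ := by
  intro x y hxy
  have hκ : ℵ₀ < Cardinal.aleph.{u} 1 := Cardinal.aleph0_lt_aleph_one
  -- The sequence and its limit form a countable generating set, so one vector state computes `φ` at
  -- all of them.
  let S : Set M.toStarSubalgebra := insert y (Set.range x)
  have hS : #S < Cardinal.aleph.{u} 1 :=
    (Cardinal.le_aleph0_iff_set_countable.2 ((Set.countable_range x).insert y)).trans_lt hκ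
  obtain ⟨ζ, hζ⟩ := hφ.exists_eq_inner_on_weakStarClosure hκ hadd.isAdditiveBelow_aleph_one hS
  have hmem : S ⊆ weakStarClosure (StarAlgebra.adjoin ℂ S) :=
    (StarAlgebra.subset_adjoin ℂ S).trans (subset_weakStarClosure _)
  have h1 : Filter.Tendsto (fun n => inner ℂ ζ ((x n : H →L[ℂ] H) ζ)) Filter.atTop
      (𝓝 (inner ℂ ζ ((y : H →L[ℂ] H) ζ))) :=
    (@Continuous.tendsto _ _ M.weakStarTopology _ _ (continuous_weakStar_inner ζ ζ) y).comp hxy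
  rw [← hζ y (hmem (Set.mem_insert _ _))] at h1
  exact h1.congr fun n => (hζ _ (hmem (Set.mem_insert_of_mem _ ⟨n, rfl⟩))).symm

end VonNeumannAlgebra

theorem theorem4p6 {H : Type u} [NormedAddCommGroup H] [InnerProductSpace ℂ H] [CompleteSpace H]
    (M : VonNeumannAlgebra H) (φ : M.toStarSubalgebra →ₗ[ℂ] ℂ)
    (hφ : VonNeumannAlgebra.IsPureState φ) :
    (∀ κ : Cardinal.{u}, ℵ₀ < κ → VonNeumannAlgebra.IsAdditiveBelow κ φ →
      ∀ (N : NonUnitalStarSubalgebra ℂ M.toStarSubalgebra) (S : Set M.toStarSubalgebra),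
        #S < κ → VonNeumannAlgebra.IsGeneratedBy N S → VonNeumannAlgebra.IsNormalOn φ N) ∧
    (VonNeumannAlgebra.IsCountablyAdditive φ → VonNeumannAlgebra.IsSeqWeakStarContinuous φ) :=
  ⟨fun _ hκ hadd _ _ hS hN => hφ.isNormalOn hκ hadd hS hN, fun hadd =>
    hφ.isSeqWeakStarContinuous hadd⟩
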